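/- Let $m \ge 2$ be even and $n\ge 1$. For a real tensor $\mathcal{T}=(\mathcal{T}_{i_1\dots i_m})$ with $m$ modes of dimension $n$, a vector $x\in\mathbb{R}^n$ and $0\le r\le m$, let $\mathcal{T}x^{m-r}$ be the $r$-mode tensor $(\mathcal{T}x^{m-r})_{i_1\dots i_r}=\sum_{i_{r+1},\dots,i_m=1}^n \mathcal{T}_{i_1\dots i_m}x_{i_{r+1}}\cdots x_{i_m}$. For symmetric $\mathcal{T}$ put $$\beta(\mathcal{T})=(m-1)\max_{\|x\|=1}\rho(\mathcal{T}x^{m-2}),$$ where $\rho$ is the spectral radius of a matrix and $\|\cdot\|$ the Euclidean norm. An eigenvector of $\mathcal{T}$ is a vector $x\in\mathbb{R}^n$ with $\|x\|=1$ and $\mathcal{T}x^{m-1}=\mu x$ for some $\mu\in\mathbb{R}$. Let $\mathcal{A}=\lambda\, a^{\otimes m}+\mathcal{E}$, where $\lambda>0$, $a\in\mathbb{R}^n$ with $\|a\|=1$, $(a^{\otimes m})_{i_1\dots i_m}=a_{i_1}\cdots a_{i_m}$, and $\mathcal{E}$ is a symmetric real tensor with $m$ modes of dimension $n$. Let $\alpha\in\mathbb{R}$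 satisfy $\alpha>\beta(\mathcal{E})$. Then for every starting vector $x_0\in\mathbb{R}^n$ with $\|x_0\|=1$, the shifted symmetric higher order power method (SS-HOPM) $$x_{k+1}=\frac{\mathcal{A}x_k^{m-1}+\alpha x_k}{\|\mathcal{A}x_k^{m-1}+\alpha x_k\|},\qquad k=0,1,2,\dots,$$ is well defined (the denominators do not vanish); the generalized Rayleigh quotient is nondecreasing along it, $\mathcal{A}x_{k}^m\le\mathcal{A}x_{k+1}^m$ for all $k$, with strict inequality whenever $x_k$ is not an eigenvector of $\mathcal{A}$; and the sequence $(x_k)$ converges to an eigenvector of $\mathcal{A}$. -/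

import Mathlib

noncomputable section

namespace SymTensor

/-- Real tensors with `m` modes, all of dimension `n`. -/
abbrev Tensor (m n : ℕ) : Type := (Fin m → Fin n) → ℝ

/-- The entries are invariant under permutation of the indices. -/
def IsSymmetric {m n : ℕ} (A : Tensor m n) : Prop :=
  ∀ (σ : Equiv.Perm (Fin m)) (i : Fin m → Fin n), A (i ∘ σ) = A i

/-- The rank-one tensor `a ⊗ a ⊗ ⋯ ⊗ a` (`m` factors). -/
def rankOne {n : ℕ} (m : ℕ) (a : EuclideanSpace ℝ (Fin n)) : Tensor m n :=
  fun i => ∏ t, a (i t)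

/-- The multi-index `(i₁, …, i_r, j₁, …, j_{m-r})`, for `r ≤ m`. -/
def joinIndex {m n : ℕ} (r : ℕ) (i : Fin r → Fin n) (j : Fin (m - r) → Fin n) :
    Fin m → Fin n :=
  fun t => if h : (t : ℕ) < r then i ⟨t, h⟩ else j ⟨(t : ℕ) - r, by omega⟩

/-- The `r`-mode tensor `A x^{m-r}`, for `r ≤ m`: the last `m - r` modes of `A` are contracted
with the vector `x`. -/
def contract {m n : ℕ} (r : ℕ) (A : Tensor m n) (x : EuclideanSpace ℝ (Fin n)) : Tensor r n :=
  fun i => ∑ j : Fin (m - r) → Fin n, A (joinIndex r i j) * ∏ t, x (j t)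

/-- The scalar `A x^m`; for `‖x‖ = 1` this is the generalized Rayleigh quotient. -/
def rayleigh {m n : ℕ} (A : Tensor m n) (x : EuclideanSpace ℝ (Fin n)) : ℝ :=
  contract 0 A x ![]

/-- The vector `A x^{m-1}`. -/
def contractVec {m n : ℕ} (A : Tensor m n) (x : EuclideanSpace ℝ (Fin n)) :
    EuclideanSpace ℝ (Fin n) :=
  WithLp.toLp 2 fun i => contract 1 A x ![i]

/-- The matrix `A x^{m-2}`. -/
def contractMat {m n : ℕ} (A : Tensor m n) (x : EuclideanSpace ℝ (Fin n)) :
    Matrix (Fin n) (Fin n) ℝ :=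
  Matrix.of fun i j => contract 2 A x ![i, j]

/-- `β(A) = (m - 1) max_{‖x‖ = 1} ρ(A x^{m-2})`, with `ρ` the spectral radius. For symmetric `A`
the matrix `A x^{m-2}` is symmetric, so all its eigenvalues are real. -/
def beta {m n : ℕ} (A : Tensor m n) : ℝ :=
  ((m : ℝ) - 1) *
    sSup ((fun x => (spectralRadius ℝ (contractMat A x)).toReal) ''
      Metric.sphere (0 : EuclideanSpace ℝ (Fin n)) 1)

/-- Normalized real (Z-)eigenvectors: `‖x‖ = 1` and `A x^{m-1} = μ x` for some real `μ`. -/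
def IsEigenvector {m n : ℕ} (A : Tensor m n) (x : EuclideanSpace ℝ (Fin n)) : Prop :=
  ‖x‖ = 1 ∧ ∃ μ : ℝ, contractVec A x = μ • x

/-- The unnormalized update `A x^{m-1} + α x`. -/
def shiftedMap {m n : ℕ} (A : Tensor m n) (α : ℝ) (x : EuclideanSpace ℝ (Fin n)) :
    EuclideanSpace ℝ (Fin n) :=
  contractVec A x + α • x

/-- The iterates of the shifted symmetric higher order power method with shift `α`,
started at `x₀`. -/
def ssHopm {m n : ℕ} (A : Tensor m n) (α : ℝ) (x₀ : EuclideanSpace ℝ (Fin n)) :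
    ℕ → EuclideanSpace ℝ (Fin n)
  | 0 => x₀
  | k + 1 => ‖shiftedMap A α (ssHopm A α x₀ k)‖⁻¹ • shiftedMap A α (ssHopm A α x₀ k)

end SymTensor

end

/-!
The shift makes `f x = A x^m + (m / 2) α ‖x‖²` strongly convex on the unit ball: the Hessian of the
rank-one part is positive semidefinite since `m` is even, and `β(E)` bounds that of `E x^m` from
below. The method replaces `x` by the unit vector along `∇f x`, so by convexity it raises `A x^m`
by at least a multiple of the squared step length.

This alone does not prevent the iterates from drifting along a continuum of eigenvectors. For that
one needs the gradient inequality of Łojasiewicz, `|f| ^ θ ≤ C ‖∇f‖` with `θ < 1` near a zero of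
`f`, which bounds the total length of the iteration. For a polynomial `f` it is proved on bounded
sets by passing to the hyperreals. If it failed for every `θ`, some finite point `x` of `ℝ*` would
have an infinitesimal value `t = f x ≠ 0` and `‖∇f x‖ ≤ |t| ^ θ` for all real `θ < 1`. Minimizing
a penalty function replaces `x` by a point algebraic over `ℝ(t)`, at the price of a factor smaller
than every power `|t| ^ (-ε)` in the bounds for `x` and `∇f x / t`. On the field generated by `x`
the order valuation is discrete with residue field `ℝ`, so this factor is harmless: `x` is finite
and `f x` divides every `∂ᵢf x` in a discrete valuation ring. Expand `x` in powers of a uniformizer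
`π` and differentiate `f x` with respect to `π`. In characteristic zero the derivative is divisible
by `π` exactly once less than `f x`, yet the chain rule makes `f x` divide it: a contradiction.
-/

noncomputable section

namespace SymTensor

section PolynomialAlgebra

open Polynomial

theorem derivation_aeval {R S M σ : Type*} [CommRing R] [CommRing S] [Algebra R S]
    [AddCommGroup M] [Module R M] [Module S M] [Fintype σ] (D : Derivation R S M)
    (f : MvPolynomial σ R) (q : σ → S) :
    D (MvPolynomial.aeval q f) =
      ∑ i, MvPolynomial.aeval q (MvPolynomial.pderiv i f) • D (q i) := by
  classical
  induction f using MvPolynomial.induction_on with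
  | C a => simp
  | add f g hf hg => simp [hf, hg, add_smul, Finset.sum_add_distrib]
  | mul_X f j hf =>
    simp [hf, MvPolynomial.pderiv_X, Pi.single_apply, add_smul,
      Finset.sum_add_distrib, Finset.smul_sum, smul_smul, apply_ite (MvPolynomial.aeval q),
      mul_comm, add_comm, ite_smul]

theorem hasDerivAt_eval_add_mul {σ : Type*} [Fintype σ] (f : MvPolynomial σ ℝ) (x v : σ → ℝ)
    (s : ℝ) :
    HasDerivAt (fun s : ℝ => MvPolynomial.eval (fun i => x i + s * v i) f)
      (∑ i, MvPolynomial.eval (fun i => x i + s * v i) (MvPolynomial.pderiv i f) * v i) s := by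
  set q : σ → ℝ[X] := fun i => C (x i) + X * C (v i) with hq
  have eval_line (s : ℝ) (g : MvPolynomial σ ℝ) :
      (MvPolynomial.aeval q g).eval s = MvPolynomial.eval (fun i => x i + s * v i) g := by
    rw [← coe_aeval_eq_eval, MvPolynomial.comp_aeval_apply, ← MvPolynomial.coe_aeval_eq_eval]
    simp only [hq, coe_aeval_eq_eval, eval_add, eval_mul, eval_C, eval_X]
    rfl
  have hderiv := (MvPolynomial.aeval q f).hasDerivAt s
  simp only [eval_line] at hderiv
  refine hderiv.congr_deriv ?_
  rw [← derivative'_apply, derivation_aeval, eval_finsetSum]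
  simp only [smul_eq_mul, eval_mul, eval_line]
  simp [hq]

theorem dvd_aeval_sub_aeval {R S σ : Type*} [CommRing R] [CommRing S] [Algebra R S] {d : S}
    {x y : σ → S} (h : ∀ i, d ∣ x i - y i) (f : MvPolynomial σ R) :
    d ∣ MvPolynomial.aeval x f - MvPolynomial.aeval y f := by
  have hxy (i : σ) : Ideal.Quotient.mk (Ideal.span {d}) (x i) = Ideal.Quotient.mk _ (y i) :=
    Ideal.Quotient.eq.2 (Ideal.mem_span_singleton.2 (h i))
  rw [← Ideal.mem_span_singleton, ← Ideal.Quotient.eq, ← Ideal.Quotient.mkₐ_eq_mk R,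
    MvPolynomial.comp_aeval_apply, MvPolynomial.comp_aeval_apply]
  simp only [Ideal.Quotient.mkₐ_eq_mk, hxy]

theorem X_pow_dvd_of_pow_dvd_aeval {k R : Type*} [Field k] [CommRing R] [IsDomain R] [Algebra k R]
    {π : R} (hπ0 : π ≠ 0) (hπ : ¬ IsUnit π) {p : k[X]} {n : ℕ} (h : π ^ n ∣ aeval π p) :
    X ^ n ∣ p := by
  induction n generalizing p with
  | zero => simp
  | succ n ih =>
    have hp : X ∣ p := by
      rw [X_dvd_iff]
      by_contra h0
      refine hπ (isUnit_of_dvd_unit ?_ ((IsUnit.mk0 _ h0).map (algebraMap k R)))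
      obtain ⟨q, hq⟩ := X_dvd_sub_C (p := p)
      have := congrArg (aeval π) hq
      simp only [map_sub, aeval_C, map_mul, aeval_X] at this
      rw [← sub_sub_cancel (aeval π p) (algebraMap k R _), this]
      exact dvd_sub ((dvd_pow_self π n.succ_ne_zero).trans h) (dvd_mul_right _ _)
    obtain ⟨q, rfl⟩ := hp
    rw [map_mul, aeval_X, pow_succ', mul_dvd_mul_iff_left hπ0] at h
    rw [pow_succ']
    exact mul_dvd_mul_left X (ih h)

theorem X_pow_succ_dvd_of_X_pow_dvd_derivative {k : Type*} [Field k] [CharZero k] {p : k[X]}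
    {n : ℕ} (hp : X ∣ p) (h : X ^ n ∣ derivative p) : X ^ (n + 1) ∣ p := by
  rw [X_pow_dvd_iff] at h ⊢
  rintro (_ | d) hd
  · exact X_dvd_iff.1 hp
  · have := h d (by omega)
    rw [coeff_derivative] at this
    exact (mul_eq_zero.1 this).resolve_right d.cast_add_one_ne_zero

end PolynomialAlgebra

section DiscreteValuationRing

open Polynomial IsLocalRing

variable {k R : Type*} [Field k] [CommRing R] [IsDomain R] [IsDiscreteValuationRing R] [Algebra k R]

theorem exists_pow_dvd_sub_aeval (hk : Function.Surjective (algebraMap k (ResidueField R)))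
    {π : R} (hπ : Irreducible π) (n : ℕ) (y : R) : ∃ q : k[X], π ^ n ∣ y - aeval π q := by
  induction n generalizing y with
  | zero => exact ⟨0, by simp⟩
  | succ n ih =>
    obtain ⟨c, hc⟩ := hk (residue R y)
    have hcy : π ∣ y - algebraMap k R c := by
      rw [← Ideal.mem_span_singleton, ← hπ.maximalIdeal_eq, ← Ideal.Quotient.eq]
      exact hc.symm
    obtain ⟨z, hz⟩ := hcy
    obtain ⟨q, hq⟩ := ih z
    refine ⟨C c + X * q, ?_⟩
    rw [map_add, aeval_C, map_mul, aeval_X, ← sub_sub, hz, ← mul_sub, pow_succ']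
    exact mul_dvd_mul_left π hq

theorem exists_not_aeval_dvd_aeval_pderiv [CharZero k] {σ : Type*} [Finite σ]
    (hk : Function.Surjective (algebraMap k (ResidueField R))) (f : MvPolynomial σ k) (x : σ → R)
    (hf0 : MvPolynomial.aeval x f ≠ 0) (hf : ¬ IsUnit (MvPolynomial.aeval x f)) :
    ∃ i, ¬ MvPolynomial.aeval x f ∣ MvPolynomial.aeval x (MvPolynomial.pderiv i f) := by
  cases nonempty_fintype σ
  obtain ⟨π, hπ⟩ := IsDiscreteValuationRing.exists_irreducible R
  obtain ⟨e, he⟩ := IsDiscreteValuationRing.associated_pow_irreducible hf0 hπ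
  have he0 : e ≠ 0 := by
    rintro rfl
    exact hf (associated_one_iff_isUnit.1 (by simpa using he))
  by_contra! hgrad
  choose q hq using fun i => exists_pow_dvd_sub_aeval hk hπ (e + 1) (x i)
  have approx (g : MvPolynomial σ k) :
      π ^ (e + 1) ∣ MvPolynomial.aeval x g - aeval π (MvPolynomial.aeval q g) := by
    have := dvd_aeval_sub_aeval hq g
    rwa [← MvPolynomial.comp_aeval_apply] at this
  have transfer {n : ℕ} (hn : n ≤ e + 1) (g : MvPolynomial σ k) :
      π ^ n ∣ aeval π (MvPolynomial.aeval q g) ↔ π ^ n ∣ MvPolynomial.aeval x g :=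
    (dvd_iff_dvd_of_dvd_sub ((pow_dvd_pow π hn).trans (approx g))).symm
  have lift_dvd {p : k[X]} {n : ℕ} : π ^ n ∣ aeval π p → X ^ n ∣ p :=
    X_pow_dvd_of_pow_dvd_aeval hπ.ne_zero hπ.not_isUnit
  have hX : X ∣ MvPolynomial.aeval q f :=
    (dvd_pow_self X he0).trans (lift_dvd ((transfer e.le_succ f).2 he.symm.dvd))
  have hX' : X ^ e ∣ derivative (MvPolynomial.aeval q f) := by
    rw [← derivative'_apply, derivation_aeval]
    exact Finset.dvd_sum fun i _ => (lift_dvd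
      ((transfer e.le_succ _).2 (he.symm.dvd.trans (hgrad i)))).mul_right _
  obtain ⟨r, hr⟩ := X_pow_succ_dvd_of_X_pow_dvd_derivative hX hX'
  have hdvd : π ^ (e + 1) ∣ π ^ e := by
    refine ((transfer le_rfl f).1 ?_).trans he.dvd
    rw [hr, map_mul, map_pow, aeval_X]
    exact dvd_mul_right _ _
  exact absurd ((pow_dvd_pow_iff hπ.ne_zero hπ.not_isUnit).1 hdvd) e.lt_succ_self.not_ge

end DiscreteValuationRing

section DiscreteValuation

open IntermediateField MonoidWithZeroHom

variable {k F K Γ : Type*} [Field k] [Field F] [Field K] [Algebra k K] [Algebra F K]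
  [LinearOrderedCommGroupWithZero Γ] (v : Valuation K Γ)

theorem exists_ne_valuation_eq_of_sum_eq_zero {ι : Type*} {s : Finset ι} {a : ι → K} {l : ι}
    (hl : l ∈ s) (hal : a l ≠ 0) (hsum : ∑ i ∈ s, a i = 0) :
    ∃ i ∈ s, ∃ j ∈ s, i ≠ j ∧ a i ≠ 0 ∧ v (a i) = v (a j) := by
  classical
  obtain ⟨i, hi, hmax⟩ := s.exists_max_image (v ∘ a) ⟨l, hl⟩
  have hai : v (a i) ≠ 0 := fun h => hal (by simpa [h] using hmax l hl)
  by_contra! hne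
  refine hai ?_
  rw [← v.map_sum_eq_of_lt hi, hsum, map_zero]
  intro j hj
  rw [Finset.mem_sdiff, Finset.mem_singleton] at hj
  exact (hmax j hj.1).lt_of_ne' (hne i hi j hj.1 (Ne.symm hj.2) (v.ne_zero_iff.1 hai))

theorem exists_valuation_pow_eq_algebraMap [FiniteDimensional F K] {y : K} (hy : y ≠ 0) :
    ∃ d, 0 < d ∧ d ≤ Module.finrank F K ∧ ∃ c : F, c ≠ 0 ∧ v y ^ d = v (algebraMap F K c) := by
  have hint : IsIntegral F y := .of_finite F y
  have hsum : ∑ i ∈ Finset.range ((minpoly F y).natDegree + 1),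
      algebraMap F K ((minpoly F y).coeff i) * y ^ i = 0 := by
    simpa only [Polynomial.aeval_eq_sum_range, Algebra.smul_def] using minpoly.aeval F y
  obtain ⟨i, hi, j, hj, hij, hci, heq⟩ := exists_ne_valuation_eq_of_sum_eq_zero v
    (Finset.self_mem_range_succ _) (by simp [minpoly.monic hint, hy]) hsum
  wlog hlt : i < j generalizing i j
  · exact this j hj i hi hij.symm (v.ne_zero_iff.1 (heq ▸ v.ne_zero_iff.2 hci)) heq.symm
      (hij.symm.lt_of_le (not_lt.1 hlt))
  have hcj : algebraMap F K ((minpoly F y).coeff j) ≠ 0 :=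
    left_ne_zero_of_mul (v.ne_zero_iff.1 (heq ▸ v.ne_zero_iff.2 hci))
  have hdeg := minpoly.natDegree_le (A := F) y
  refine ⟨j - i, by omega, by rw [Finset.mem_range] at hj; omega,
    (minpoly F y).coeff i / (minpoly F y).coeff j, ?_, ?_⟩
  · exact div_ne_zero ((map_ne_zero _).1 (left_ne_zero_of_mul hci)) ((map_ne_zero _).1 hcj)
  · rw [map_div₀, map_div₀, eq_div_iff (v.ne_zero_iff.2 hcj),
      pow_sub₀ _ (v.ne_zero_iff.2 hy) hlt.le, mul_right_comm, ← div_eq_mul_inv,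
      div_eq_iff (pow_ne_zero i (v.ne_zero_iff.2 hy)), mul_comm]
    simpa only [map_mul, map_pow] using heq.symm

variable [Algebra k F] [IsScalarTower k F K] [v.IsTrivialOn k] {w : F}

theorem exists_valuation_algebraMap_eq_zpow (hF : k⟮w⟯ = ⊤) (hw : 1 < v (algebraMap F K w))
    {z : F} (hz : z ≠ 0) : ∃ j : ℤ, v (algebraMap F K z) = v (algebraMap F K w) ^ j := by
  obtain ⟨p, q, rfl⟩ := mem_adjoin_simple_iff k z |>.1 (hF ▸ mem_top)
  have hp : p ≠ 0 := by rintro rfl; simp at hz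
  have hq : q ≠ 0 := by rintro rfl; simp at hz
  refine ⟨p.natDegree - q.natDegree, ?_⟩
  rw [map_div₀, map_div₀, ← Polynomial.aeval_algebraMap_apply, ← Polynomial.aeval_algebraMap_apply,
    Polynomial.valuation_aeval_eq_valuation_X_pow_natDegree_of_one_lt_valuation_X _ hw hp,
    Polynomial.valuation_aeval_eq_valuation_X_pow_natDegree_of_one_lt_valuation_X _ hw hq,
    zpow_sub₀ (zero_lt_one.trans hw).ne', zpow_natCast, zpow_natCast]

theorem isDiscreteValuationRing_valuationSubring [FiniteDimensional F K] (hF : k⟮w⟯ = ⊤)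
    (hw : 1 < v (algebraMap F K w)) : IsDiscreteValuationRing v.valuationSubring := by
  set N := (Module.finrank F K).factorial
  set γ : Γˣ := Units.mk0 (v (algebraMap F K w)) (zero_lt_one.trans hw).ne'
  have hpow (u : valueGroup (.ofClass v)) : (u : Γˣ) ^ N ∈ Subgroup.zpowers γ := by
    obtain ⟨⟨y, hy⟩, -⟩ : ((u : Γˣ) : Γ) ∈ Set.range (MonoidWithZeroHom.ofClass v) \ {0} :=
      valueGroup_eq_range (.ofClass v) ▸ Set.mem_image_of_mem Units.val u.2
    have hy0 : y ≠ 0 := v.ne_zero_iff.1 (hy ▸ Units.ne_zero _ : v y ≠ 0)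
    obtain ⟨d, hd, hdN, c, hc, hyc⟩ := exists_valuation_pow_eq_algebraMap (F := F) v hy0
    obtain ⟨j, hj⟩ := exists_valuation_algebraMap_eq_zpow v hF hw hc
    obtain ⟨l, hl⟩ : d ∣ N := Nat.dvd_factorial hd hdN
    rw [hl, pow_mul]
    refine pow_mem (Subgroup.mem_zpowers_iff.2 ⟨j, Units.ext ?_⟩) l
    simpa [γ, ← hy, hyc] using hj.symm
  have : IsCyclic (valueGroup (.ofClass v)) :=
    isCyclic_of_injective
      (((powMonoidHom N).comp (valueGroup (.ofClass v)).subtype).codRestrict _ hpow)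
      fun u u' h => Subtype.ext
        (pow_left_injective (Nat.factorial_ne_zero _) (congrArg Subtype.val h))
  have : Nontrivial (valueGroup (.ofClass v)) :=
    ⟨⟨γ, mem_valueGroup _ ⟨_, rfl⟩⟩, 1,
      fun h => hw.ne' (congrArg (fun u : valueGroup (.ofClass v) => ((u : Γˣ) : Γ)) h)⟩
  infer_instance

end DiscreteValuation

section Integrality

open MvPolynomial

variable {R B σ : Type*} [CommRing R] [CommRing B] [Algebra R B] {D : ℕ} {x : σ → B}
  {P : σ → MvPolynomial σ R}

theorem exists_aeval_eq_aeval_monomial_of_le (hP : ∀ i, (P i).totalDegree < D)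
    (hx : ∀ i, x i ^ D = aeval x (P i)) (β : σ →₀ ℕ) {i : σ} (hi : D ≤ β i) :
    ∃ p : MvPolynomial σ R, p.totalDegree < β.degree ∧
      aeval x p = aeval x (monomial β (1 : R)) := by
  classical
  obtain ⟨γ, rfl⟩ : ∃ γ, β = Finsupp.single i D + γ :=
    le_iff_exists_add.1 (Finsupp.single_le_iff.2 hi)
  refine ⟨P i * monomial γ 1, ?_, ?_⟩
  · calc (P i * monomial γ 1).totalDegree ≤ (P i).totalDegree + γ.degree :=
          (totalDegree_mul _ _).trans (Nat.add_le_add_left (totalDegree_monomial_le _ _) _)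
      _ < D + γ.degree := Nat.add_lt_add_right (hP i) _
      _ = (Finsupp.single i D + γ).degree := by rw [map_add, Finsupp.degree_single]
  · rw [map_mul, ← hx i, monomial_single_add, map_mul, map_pow, aeval_X]

theorem aeval_mem_span_of_pow_eq_aeval [Fintype σ] (hP : ∀ i, (P i).totalDegree < D)
    (hx : ∀ i, x i ^ D = aeval x (P i)) (p : MvPolynomial σ R) :
    aeval x p ∈ Submodule.span R (Set.range fun β : σ → Fin D => ∏ i, x i ^ (β i : ℕ)) := by
  induction hd : p.totalDegree using Nat.strong_induction_on generalizing p with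
  | _ d ih =>
    rw [p.as_sum, map_sum]
    refine Submodule.sum_mem _ fun β hβ => ?_
    rw [← mul_one (p.coeff β), ← smul_eq_mul, ← smul_monomial, map_smul]
    refine Submodule.smul_mem _ _ ?_
    by_cases hβD : ∀ i, β i < D
    · refine Submodule.subset_span ⟨fun i => ⟨β i, hβD i⟩, ?_⟩
      simp [aeval_monomial, Finsupp.prod_fintype]
    · push Not at hβD
      obtain ⟨i, hi⟩ := hβD
      obtain ⟨r, hr, hrβ⟩ := exists_aeval_eq_aeval_monomial_of_le hP hx β hi
      rw [← hrβ]
      exact ih _ (hr.trans_le ((le_totalDegree hβ).trans hd.le)) r rfl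

theorem isIntegral_of_pow_eq_aeval [Finite σ] (hP : ∀ i, (P i).totalDegree < D)
    (hx : ∀ i, x i ^ D = aeval x (P i)) (i : σ) : IsIntegral R (x i) := by
  cases nonempty_fintype σ
  have hspan : Subalgebra.toSubmodule (aeval (R := R) x).range =
      Submodule.span R (Set.range fun β : σ → Fin D => ∏ i, x i ^ (β i : ℕ)) := by
    refine le_antisymm ?_ (Submodule.span_le.2 ?_)
    · rintro _ ⟨p, rfl⟩
      exact aeval_mem_span_of_pow_eq_aeval hP hx p
    · rintro _ ⟨β, rfl⟩
      exact ⟨∏ i, X i ^ (β i : ℕ), by simp⟩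
  exact .of_mem_of_fg (aeval x).range (hspan ▸ Submodule.fg_span (Set.finite_range _)) _
    ⟨X i, aeval_X x i⟩

end Integrality

section TrivialOnConstants

open IsLocalRing

variable {k K Γ : Type*} [Field k] [Field K] [Algebra k K] [LinearOrderedCommGroupWithZero Γ]
  (v : Valuation K Γ)

theorem valuation_le_one_of_forall_mul_pow_le_one [IsDiscreteValuationRing v.valuationSubring]
    {t z : K} (ht : t ≠ 0) (h : ∀ N : ℕ, v (t * z ^ N) ≤ 1) : v z ≤ 1 := by
  have hz : IsAlmostIntegral v.valuationSubring z :=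
    ⟨⟨t, by simpa using h 0⟩, mem_nonZeroDivisors_of_ne_zero (Subtype.coe_ne_coe.1 ht),
      fun N => ⟨⟨_, h N⟩, rfl⟩⟩
  obtain ⟨y, rfl⟩ := IsIntegrallyClosed.isIntegral_iff.1 hz.isIntegral
  exact y.2

theorem exists_valuation_aeval_lt_aeval_pderiv [CharZero k] [v.IsTrivialOn k]
    [IsDiscreteValuationRing v.valuationSubring]
    (hk : ∀ y, v y ≤ 1 → ∃ c : k, v (y - algebraMap k K c) < 1) {σ : Type*} [Finite σ]
    (f : MvPolynomial σ k) {x : σ → K} (hx : ∀ i, v (x i) ≤ 1)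
    (hf0 : MvPolynomial.aeval x f ≠ 0) (hf : v (MvPolynomial.aeval x f) < 1) :
    ∃ i, v (MvPolynomial.aeval x f) < v (MvPolynomial.aeval x (MvPolynomial.pderiv i f)) := by
  let : Algebra k v.valuationSubring := ((algebraMap k K).codRestrict v.valuationSubring
    (Valuation.IsTrivialOn.valuation_algebraMap_le_one v)).toAlgebra
  have : IsScalarTower k v.valuationSubring K := .of_algebraMap_eq fun _ => rfl
  have hsurj : Function.Surjective (algebraMap k (ResidueField v.valuationSubring)) := by
    intro y
    obtain ⟨y, rfl⟩ := residue_surjective y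
    obtain ⟨c, hc⟩ := hk y y.2
    refine ⟨c, (Ideal.Quotient.eq.2 ?_).symm⟩
    exact Valuation.Integer.not_isUnit_iff_valuation_lt_one.2 hc
  set X : σ → v.valuationSubring := fun i => ⟨x i, hx i⟩
  have coe_aeval (g : MvPolynomial σ k) : (MvPolynomial.aeval X g : K) = MvPolynomial.aeval x g :=
    (MvPolynomial.aeval_algebraMap_apply K X g).symm
  obtain ⟨i, hi⟩ := exists_not_aeval_dvd_aeval_pderiv hsurj f X
    (fun h => hf0 (by rw [← coe_aeval, h]; rfl))
    (Valuation.Integer.not_isUnit_iff_valuation_lt_one.2 ((coe_aeval f).symm ▸ hf))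
  refine ⟨i, not_le.1 fun hle => hi ?_⟩
  rw [← coe_aeval, ← coe_aeval] at hle
  exact (Valuation.integer.integers v).dvd_of_le hle

end TrivialOnConstants

section OrderedField

open ArchimedeanClass

variable {L : Type*} [Field L] [LinearOrder L] [IsStrictOrderedRing L]

theorem mk_nonneg_of_sq_nonneg {y : L} (h : 0 ≤ mk (y ^ 2)) : 0 ≤ mk y := by
  contrapose! h
  rw [mk_pow, two_nsmul]
  exact (add_le_of_nonpos_left h.le).trans_lt h

theorem mk_mul_pow_nonneg_of_sq_le {t z H : L} (ht : 0 ≤ mk t) (hz : z ^ 2 ≤ H)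
    (hH : ∀ N : ℕ, 0 ≤ mk (t * H ^ N)) (N : ℕ) : 0 ≤ mk (t * z ^ N) := by
  have h : |z ^ (2 * N)| ≤ |H ^ N| := by
    rw [abs_of_nonneg ((even_two_mul N).pow_nonneg z), pow_mul]
    exact (pow_le_pow_left₀ (sq_nonneg z) hz N).trans (le_abs_self _)
  refine mk_nonneg_of_sq_nonneg ?_
  calc (0 : ArchimedeanClass L) ≤ mk t + mk (t * H ^ N) := add_nonneg ht (hH N)
    _ ≤ mk t + mk (t * z ^ (2 * N)) := by
      rw [mk_mul, mk_mul]
      gcongr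
      exact mk_le_mk_of_abs h
    _ = mk ((t * z ^ N) ^ 2) := by rw [← mk_mul]; ring_nf

theorem mk_eq_mk_of_sub_sq_le {t δ y : L} (ht0 : t ≠ 0) (hδ : 0 < mk δ)
    (h : (y - t) ^ 2 ≤ t ^ 2 * δ) : mk y = mk t := by
  have hle : ((y - t) / t) ^ 2 ≤ δ := by
    rw [div_pow, div_le_iff₀' (by positivity)]
    exact h
  have hsq : 0 < mk (((y - t) / t) ^ 2) :=
    hδ.trans_le (mk_antitoneOn (sq_nonneg _) ((sq_nonneg _).trans hle) hle)
  have hpos : 0 < mk ((y - t) / t) := by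
    contrapose! hsq
    rw [mk_pow, two_nsmul]
    exact add_nonpos hsq hsq
  have hone : mk (1 + (y - t) / t) = 0 := by
    rw [mk_add_eq_mk_left (by rwa [mk_one]), mk_one]
  rw [show y = t * (1 + (y - t) / t) by field_simp; ring, mk_mul, hone, add_zero]

variable [Algebra ℝ L]

variable (L) in
/-- The structure map of an ordered field over `ℝ`; it is monotone because nonnegative reals are
squares. -/
def realOrderHom : ℝ →+*o L :=
  { algebraMap ℝ L with
    monotone' := fun a b hab => sub_nonneg.1 <| by
      simpa [← map_sub, ← map_pow, Real.sq_sqrt (sub_nonneg.2 hab)] using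
        sq_nonneg (algebraMap ℝ L √(b - a)) }

section Field

variable {F : Type*} [Field F] [Algebra F L]

/-- The valuation of a subfield of `L` whose valuation ring consists of the elements that are finite
with respect to the order of `L`. -/
def orderValuation (K : IntermediateField F L) :
    Valuation K (Multiplicative (ArchimedeanClass L)ᵒᵈ) :=
  (addValuation L).toValuation.comap (algebraMap K L)

variable {K : IntermediateField F L} {y : K}

variable [Algebra ℝ F] [IsScalarTower ℝ F L]

instance : (orderValuation K).IsTrivialOn ℝ := ⟨fun a ha => by
  exact mk_map_of_archimedean' (realOrderHom L) ha⟩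

theorem exists_orderValuation_sub_algebraMap_lt_one (hy : orderValuation K y ≤ 1) :
    ∃ c : ℝ, orderValuation K (y - algebraMap ℝ K c) < 1 :=
  ⟨stdPart (y : L), mk_sub_stdPart_pos (realOrderHom L) hy⟩

end Field

open scoped IntermediateField

theorem isDiscreteValuationRing_orderValuation {t : L} (ht0 : t ≠ 0) (ht : 0 < mk t)
    (K : IntermediateField ℝ⟮t⁻¹⟯ L) [FiniteDimensional ℝ⟮t⁻¹⟯ K] :
    IsDiscreteValuationRing (orderValuation K).valuationSubring := by
  refine isDiscreteValuationRing_valuationSubring (k := ℝ) (F := ℝ⟮t⁻¹⟯) (orderValuation K)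
    (w := IntermediateField.AdjoinSimple.gen ℝ t⁻¹) ?_ ?_
  · apply IntermediateField.lift_injective
    rw [IntermediateField.lift_adjoin_simple, IntermediateField.lift_top]
    rfl
  · change mk t⁻¹ < 0
    by_contra! h
    exact (add_pos_of_pos_of_nonneg ht h).ne' (by rw [← mk_mul, mul_inv_cancel₀ ht0, mk_one])

theorem mk_nonneg_of_forall_mul_pow {t : L} (ht0 : t ≠ 0) (ht : 0 < mk t)
    {K : IntermediateField ℝ⟮t⁻¹⟯ L} [FiniteDimensional ℝ⟮t⁻¹⟯ K] {z : L} (hz : z ∈ K)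
    (h : ∀ N : ℕ, 0 ≤ mk (t * z ^ N)) : 0 ≤ mk z := by
  have := isDiscreteValuationRing_orderValuation ht0 ht K
  have htK : t ∈ K := by
    simpa using K.inv_mem (K.algebraMap_mem (IntermediateField.AdjoinSimple.gen ℝ t⁻¹))
  exact valuation_le_one_of_forall_mul_pow_le_one (orderValuation K) (t := ⟨t, htK⟩)
    (z := ⟨z, hz⟩) (Subtype.coe_ne_coe.1 ht0) h

theorem exists_mk_aeval_pderiv_lt {t : L} (ht0 : t ≠ 0) (ht : 0 < mk t)
    {K : IntermediateField ℝ⟮t⁻¹⟯ L} [FiniteDimensional ℝ⟮t⁻¹⟯ K] {σ : Type*} [Finite σ]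
    (f : MvPolynomial σ ℝ) {x : σ → K} (hx : ∀ i, 0 ≤ mk (x i : L))
    (hf0 : MvPolynomial.aeval x f ≠ 0) (hf : 0 < mk (MvPolynomial.aeval x f : L)) :
    ∃ i, mk (MvPolynomial.aeval x (MvPolynomial.pderiv i f) : L) <
      mk (MvPolynomial.aeval x f : L) := by
  have := isDiscreteValuationRing_orderValuation ht0 ht K
  exact exists_valuation_aeval_lt_aeval_pderiv (orderValuation K)
    (fun _ => exists_orderValuation_sub_algebraMap_lt_one) f hx hf0 hf

theorem exists_lt_sq_aeval_pderiv {t H : L} (ht0 : t ≠ 0) (ht : 0 < mk t)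
    (hH : ∀ N : ℕ, 0 ≤ mk (t * H ^ N)) {σ : Type*} [Finite σ] (f : MvPolynomial σ ℝ) {x : σ → L}
    (hx : ∀ i, IsIntegral ℝ⟮t⁻¹⟯ (x i)) (hxH : ∀ i, x i ^ 2 ≤ H)
    (hf : (MvPolynomial.aeval x f - t) ^ 2 ≤ t ^ 4 * H) :
    ∃ i, t ^ 2 * H < MvPolynomial.aeval x (MvPolynomial.pderiv i f) ^ 2 := by
  set K := IntermediateField.adjoin ℝ⟮t⁻¹⟯ (Set.range x)
  have : FiniteDimensional ℝ⟮t⁻¹⟯ K :=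
    IntermediateField.finiteDimensional_adjoin (by rintro _ ⟨i, rfl⟩; exact hx i)
  have : IsScalarTower ℝ K L := .of_algebraMap_eq fun _ => rfl
  set X : σ → K := fun i => ⟨x i, IntermediateField.subset_adjoin _ _ ⟨i, rfl⟩⟩
  have coe_aeval (g : MvPolynomial σ ℝ) : (MvPolynomial.aeval X g : L) = MvPolynomial.aeval x g :=
    (MvPolynomial.aeval_algebraMap_apply L X g).symm
  have htK : t ∈ K := by
    simpa using K.inv_mem (K.algebraMap_mem (IntermediateField.AdjoinSimple.gen ℝ t⁻¹))
  have finite_of_sq_le {z : L} (hz : z ∈ K) (hzH : z ^ 2 ≤ H) : 0 ≤ mk z :=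
    mk_nonneg_of_forall_mul_pow ht0 ht hz (mk_mul_pow_nonneg_of_sq_le ht.le hzH hH)
  have hft : mk (MvPolynomial.aeval x f) = mk t := by
    have hδ : 0 < mk (t * (t * H ^ 1)) := mk_mul t _ ▸ add_pos_of_pos_of_nonneg ht (hH 1)
    exact mk_eq_mk_of_sub_sq_le ht0 hδ (hf.trans_eq (by ring))
  obtain ⟨i, hi⟩ := exists_mk_aeval_pderiv_lt ht0 ht f (x := X)
    (fun i => finite_of_sq_le (X i).2 (hxH i))
    (fun h0 => ht0 <| by simpa [← coe_aeval, h0, eq_comm] using hft) (by rwa [coe_aeval, hft])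
  rw [coe_aeval, coe_aeval, hft] at hi
  refine ⟨i, not_le.1 fun hle => hi.not_ge ?_⟩
  have hdiv : 0 ≤ mk (MvPolynomial.aeval x (MvPolynomial.pderiv i f) / t) := by
    refine finite_of_sq_le (K.div_mem (coe_aeval _ ▸ SetLike.coe_mem _) htK) ?_
    rw [div_pow, div_le_iff₀' (by positivity)]
    exact hle
  rw [← div_mul_cancel₀ (MvPolynomial.aeval x (MvPolynomial.pderiv i f)) ht0, mk_mul]
  exact le_add_of_nonneg_left hdiv

end OrderedField

section GradientInequality

open MvPolynomial

variable {σ : Type*}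

theorem totalDegree_pderiv_le {R : Type*} [CommRing R] (i : σ) (f : MvPolynomial σ R) :
    (pderiv i f).totalDegree ≤ f.totalDegree := by
  conv_lhs => rw [f.as_sum, map_sum]
  refine totalDegree_finsetSum_le fun β hβ => ?_
  rw [pderiv_monomial]
  exact (totalDegree_monomial_le _ _).trans <|
    (Finsupp.degree_mono tsub_le_self).trans (le_totalDegree hβ)

theorem eval_pderiv_eq_zero_of_forall_eval_le [Finite σ] {f : MvPolynomial σ ℝ} {x : σ → ℝ}
    (h : ∀ z, eval x f ≤ eval z f) (i : σ) : eval x (pderiv i f) = 0 := by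
  classical
  cases nonempty_fintype σ
  have hmin : IsLocalMin (fun s : ℝ => eval (fun j => x j + s * (Pi.single i 1 : σ → ℝ) j) f) 0 :=
    Filter.Eventually.of_forall fun s => by simpa using h _
  simpa [Pi.single_apply] using hmin.hasDerivAt_eq_zero (hasDerivAt_eval_add_mul f x _ 0)

variable [Fintype σ]

section Penalty

variable {R : Type*} [CommRing R]

/-- The squared Euclidean norm of the gradient of a polynomial. -/
def gradNormSq (f : MvPolynomial σ R) : MvPolynomial σ R := ∑ i, pderiv i f ^ 2

/-- A coercive polynomial whose minimizers nearly solve `f = t` with small gradient of `f`. Its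
leading term `t ^ 4 * ∑ i, x i ^ (2 * M)` makes the critical points algebraic over the field
generated by `t`. -/
def penalty (f : MvPolynomial σ R) (M : ℕ) (t : R) : MvPolynomial σ R :=
  (f - C t) ^ 2 + C (t ^ 2) * gradNormSq f + C (t ^ 4) * ∑ i, X i ^ (2 * M)

theorem eval_gradNormSq (f : MvPolynomial σ R) (x : σ → R) :
    eval x (gradNormSq f) = ∑ i, eval x (pderiv i f) ^ 2 := by
  simp only [gradNormSq, map_sum, map_pow]

theorem map_gradNormSq {S : Type*} [CommRing S] (φ : R →+* S) (f : MvPolynomial σ R) :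
    map φ (gradNormSq f) = gradNormSq (map φ f) := by
  simp only [gradNormSq, map_sum, map_pow, pderiv_map]

theorem totalDegree_gradNormSq_le (f : MvPolynomial σ R) :
    (gradNormSq f).totalDegree ≤ 2 * f.totalDegree :=
  totalDegree_finsetSum_le fun i _ =>
    (totalDegree_pow _ 2).trans (Nat.mul_le_mul_left 2 (totalDegree_pderiv_le i f))

theorem eval_penalty (f : MvPolynomial σ R) (M : ℕ) (t : R) (x : σ → R) :
    eval x (penalty f M t) =
      (eval x f - t) ^ 2 + t ^ 2 * eval x (gradNormSq f) + t ^ 4 * ∑ i, x i ^ (2 * M) := by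
  simp only [penalty, map_add, map_mul, map_pow, map_sub, map_sum, eval_C, eval_X]

theorem pderiv_penalty (f : MvPolynomial σ R) (M : ℕ) (t : R) (i : σ) :
    pderiv i (penalty f M t) = 2 * (f - C t) * pderiv i f + C (t ^ 2) * pderiv i (gradNormSq f) +
      C (t ^ 4 * (2 * M : ℕ)) * X i ^ (2 * M - 1) := by
  classical
  have hsum : pderiv i (∑ j, X j ^ (2 * M) : MvPolynomial σ R) =
      C ((2 * M : ℕ) : R) * X i ^ (2 * M - 1) := by
    rw [map_sum, Finset.sum_eq_single i]
    · rw [pderiv_pow, pderiv_X_self, mul_one, map_natCast]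
    · intro j _ hj
      rw [pderiv_pow, pderiv_X_of_ne hj, mul_zero]
    · exact fun h => absurd (Finset.mem_univ i) h
  rw [penalty, map_add, map_add, pderiv_C_mul, pderiv_C_mul, hsum, pderiv_pow, map_sub, pderiv_C,
    sub_zero, pow_one, C_mul, mul_assoc (C (t ^ 4)), Nat.cast_ofNat]

theorem aeval_pderiv_penalty_map {S A : Type*} [CommRing S] [CommRing A] [Algebra R S] [Algebra S A]
    [Algebra R A] [IsScalarTower R S A] (f : MvPolynomial σ R) (M : ℕ) (t : S) (x : σ → A) (i : σ) :
    aeval x (pderiv i (penalty (map (algebraMap R S) f) M t)) =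
      2 * (aeval x f - algebraMap S A t) * aeval x (pderiv i f) +
        algebraMap S A t ^ 2 * aeval x (pderiv i (gradNormSq f)) +
          algebraMap S A t ^ 4 * (2 * M : ℕ) * x i ^ (2 * M - 1) := by
  simp only [pderiv_penalty, ← map_gradNormSq, pderiv_map, map_add, map_mul, map_sub, map_pow,
    map_ofNat, map_natCast, aeval_C, aeval_X, aeval_map_algebraMap]

theorem isIntegral_of_aeval_pderiv_penalty_eq_zero {F L : Type*} [Field F] [CharZero F]
    [CommRing L] [Algebra F L] {f : MvPolynomial σ F} {M : ℕ} (hM : f.totalDegree < M) {t : F}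
    (ht : t ≠ 0) {x : σ → L} (h : ∀ i, aeval x (pderiv i (penalty f M t)) = 0) (i : σ) :
    IsIntegral F (x i) := by
  set c : F := t ^ 4 * (2 * M : ℕ)
  have hc : c ≠ 0 := mul_ne_zero (pow_ne_zero 4 ht) (Nat.cast_ne_zero.2 (by omega))
  set P : σ → MvPolynomial σ F := fun i =>
    2 * (f - C t) * pderiv i f + C (t ^ 2) * pderiv i (gradNormSq f)
  have degree_C_mul_le (b : F) (p : MvPolynomial σ F) : (C b * p).totalDegree ≤ p.totalDegree := by
    simpa using totalDegree_mul (C b) p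
  have hP (i : σ) : (P i).totalDegree ≤ 2 * f.totalDegree := by
    refine (totalDegree_add _ _).trans (max_le ?_ ?_)
    · have hsub : (f - C t).totalDegree ≤ f.totalDegree := by
        simpa using totalDegree_sub f (C t)
      rw [mul_assoc, show (2 : MvPolynomial σ F) = C 2 from (map_ofNat C 2).symm, two_mul]
      exact (degree_C_mul_le _ _).trans ((totalDegree_mul _ _).trans
        (add_le_add hsub (totalDegree_pderiv_le i f)))
    · exact (degree_C_mul_le _ _).trans
        ((totalDegree_pderiv_le i _).trans (totalDegree_gradNormSq_le f))
  refine isIntegral_of_pow_eq_aeval (D := 2 * M - 1) (P := fun i => C (-c⁻¹) * P i) (fun i => ?_)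
    (fun i => ?_) i
  · exact (degree_C_mul_le _ _).trans_lt ((hP i).trans_lt (by omega))
  · have hi := h i
    rw [pderiv_penalty, map_add, map_mul _ (C _), aeval_C, map_pow (aeval x) (X i), aeval_X] at hi
    have hPi : aeval x (P i) = -(algebraMap F L c * x i ^ (2 * M - 1)) :=
      eq_neg_of_add_eq_zero_left hi
    rw [map_mul, aeval_C, hPi, map_neg, neg_mul_neg, ← mul_assoc, ← map_mul, inv_mul_cancel₀ hc,
      map_one, one_mul]

end Penalty

theorem exists_forall_eval_penalty_le (f : MvPolynomial σ ℝ) {M : ℕ} (hM : M ≠ 0) {t : ℝ}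
    (ht : t ≠ 0) : ∃ x, ∀ z, eval x (penalty f M t) ≤ eval z (penalty f M t) := by
  set c := eval 0 (penalty f M t)
  set r := max 1 (c / t ^ 4)
  refine (continuous_eval _).exists_forall_le' 0 ?_
  filter_upwards [(isCompact_closedBall (0 : σ → ℝ) r).compl_mem_cocompact] with z hz
  obtain ⟨i, hi⟩ : ∃ i, r < |z i| := by
    simpa [pi_norm_le_iff_of_nonneg (zero_le_one.trans (le_max_left 1 _) : 0 ≤ r)] using hz
  have h1 : 1 ≤ |z i| := (le_max_left _ _).trans hi.le
  have hzi : c / t ^ 4 ≤ z i ^ (2 * M) := calc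
    c / t ^ 4 ≤ |z i| := (le_max_right _ _).trans hi.le
    _ ≤ |z i| ^ (2 * M) := le_self_pow₀ h1 (by omega)
    _ = z i ^ (2 * M) := (even_two_mul M).pow_abs (z i)
  have hgrad : 0 ≤ eval z (gradNormSq f) := by
    rw [eval_gradNormSq]
    positivity
  calc c ≤ t ^ 4 * z i ^ (2 * M) := (div_le_iff₀' (by positivity)).1 hzi
    _ ≤ t ^ 4 * ∑ j, z j ^ (2 * M) := by
      gcongr
      exact Finset.single_le_sum (f := fun j => z j ^ (2 * M))
        (fun j _ => (even_two_mul M).pow_nonneg (z j)) (Finset.mem_univ i)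
    _ ≤ eval z (penalty f M t) := by
      rw [eval_penalty]
      exact le_add_of_nonneg_left (by positivity)

theorem exists_eval_pderiv_penalty_eq_zero (f : MvPolynomial σ ℝ) {M : ℕ} (hM : M ≠ 0) {t : ℝ}
    (ht : t ≠ 0) {y : σ → ℝ} (hy : eval y f = t) {H : ℝ} (hH1 : 1 ≤ H)
    (hH : eval y (gradNormSq f) + t ^ 2 * ∑ i, y i ^ (2 * M) ≤ t ^ 2 * H) :
    ∃ x : σ → ℝ, (∀ i, eval x (pderiv i (penalty f M t)) = 0) ∧ (∀ i, x i ^ 2 ≤ H) ∧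
      (eval x f - t) ^ 2 ≤ t ^ 4 * H ∧ ∀ i, eval x (pderiv i f) ^ 2 ≤ t ^ 2 * H := by
  obtain ⟨x, hx⟩ := exists_forall_eval_penalty_le f hM ht
  have hle : (eval x f - t) ^ 2 + t ^ 2 * eval x (gradNormSq f) + t ^ 4 * ∑ i, x i ^ (2 * M) ≤
      t ^ 4 * H := by
    have := hx y
    rw [eval_penalty, eval_penalty, hy] at this
    nlinarith [sq_nonneg t]
  have hgrad : 0 ≤ eval x (gradNormSq f) := by
    rw [eval_gradNormSq]
    positivity
  have hpow (i : σ) : (x i ^ 2) ^ M ≤ ∑ i, x i ^ (2 * M) :=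
    pow_mul (x i) 2 M ▸ Finset.single_le_sum (f := fun i => x i ^ (2 * M))
      (fun i _ => (even_two_mul M).pow_nonneg (x i)) (Finset.mem_univ i)
  have hnorm : 0 ≤ ∑ i, x i ^ (2 * M) :=
    Finset.sum_nonneg fun i _ => (even_two_mul M).pow_nonneg (x i)
  have ht2 : 0 < t ^ 2 := by positivity
  have hnormH : ∑ i, x i ^ (2 * M) ≤ H := by
    refine le_of_mul_le_mul_left ?_ (pow_pos ht2 2)
    nlinarith [sq_nonneg (eval x f - t), mul_nonneg ht2.le hgrad]
  have hgradH : eval x (gradNormSq f) ≤ t ^ 2 * H := by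
    refine le_of_mul_le_mul_left ?_ ht2
    nlinarith [sq_nonneg (eval x f - t), mul_nonneg (pow_pos ht2 2).le hnorm]
  refine ⟨x, eval_pderiv_eq_zero_of_forall_eval_le hx, fun i => ?_, ?_, fun i => ?_⟩
  · rcases le_total (x i ^ 2) 1 with h1 | h1
    · exact h1.trans hH1
    · exact (le_self_pow₀ h1 hM).trans ((hpow i).trans hnormH)
  · nlinarith [mul_nonneg ht2.le hgrad, mul_nonneg (pow_pos ht2 2).le hnorm]
  · refine le_trans ?_ hgradH
    rw [eval_gradNormSq]
    exact Finset.single_le_sum (f := fun i => eval x (pderiv i f) ^ 2)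
      (fun i _ => sq_nonneg _) (Finset.mem_univ i)

section Hyperreal

open ArchimedeanClass Filter
open Hyperreal (ofSeq ofSeq_le_ofSeq)
open scoped IntermediateField Topology

/-- The hyperreals as an extension of `ℝ` by the constant sequences. -/
instance hyperrealAlgebra : Algebra ℝ Hyperreal := Hyperreal.coeRingHom.toRingHom.toAlgebra

theorem aeval_ofSeq {σ : Type*} (f : MvPolynomial σ ℝ) (x : ℕ → σ → ℝ) :
    aeval (fun i => ofSeq fun k => x k i) f = ofSeq fun k => eval (x k) f := by
  induction f using MvPolynomial.induction_on with
  | C a => simp only [aeval_C, eval_C]; rfl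
  | add p q hp hq => simp only [map_add, hp, hq]; rfl
  | mul_X p i hp => simp only [map_mul, hp, aeval_X, eval_X]; rfl

theorem mk_ofSeq_nonneg {a : ℕ → ℝ} {c : ℝ} (h : ∀ᶠ k in atTop, |a k| ≤ c) : 0 ≤ mk (ofSeq a) :=
  mk_nonneg_of_le_of_le_of_archimedean Hyperreal.coeRingHom (r := -c) (s := c)
    (ofSeq_le_ofSeq.2 (Nat.hyperfilter_le_atTop (h.mono fun _ hk => (abs_le.1 hk).1)))
    (ofSeq_le_ofSeq.2 (Nat.hyperfilter_le_atTop (h.mono fun _ hk => (abs_le.1 hk).2)))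

theorem isIntegral_ofSeq_of_eval_pderiv_penalty_eq_zero {f : MvPolynomial σ ℝ} {M : ℕ}
    (hM : f.totalDegree < M) {t : ℕ → ℝ} (ht : ofSeq t ≠ 0) {x : ℕ → σ → ℝ}
    (hx : ∀ k i, eval (x k) (pderiv i (penalty f M (t k))) = 0) (i : σ) :
    IsIntegral ℝ⟮(ofSeq t)⁻¹⟯ (ofSeq fun k => x k i) := by
  set F := ℝ⟮(ofSeq t)⁻¹⟯
  set τ : F := (IntermediateField.AdjoinSimple.gen ℝ (ofSeq t)⁻¹)⁻¹
  have hτ : algebraMap F Hyperreal τ = ofSeq t := by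
    rw [map_inv₀, IntermediateField.AdjoinSimple.algebraMap_gen, inv_inv]
  refine isIntegral_of_aeval_pderiv_penalty_eq_zero (f := map (algebraMap ℝ F) f) (t := τ)
    (x := fun i => ofSeq fun k => x k i)
    ((Finset.sup_mono (support_map_subset _ f)).trans_lt hM)
    (fun h => ht (by rw [← hτ, h, map_zero])) (fun i => ?_) i
  rw [aeval_pderiv_penalty_map, hτ, aeval_ofSeq, aeval_ofSeq, aeval_ofSeq]
  have hreal (k : ℕ) :
      aeval (x k) (pderiv i (penalty (map (algebraMap ℝ ℝ) f) M (t k))) = 0 := by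
    rw [Algebra.algebraMap_self, MvPolynomial.map_id]
    exact hx k i
  simp only [aeval_pderiv_penalty_map] at hreal
  exact congrArg ofSeq (_root_.funext hreal)

theorem exists_lt_sq_eval_pderiv (f : MvPolynomial σ ℝ) {M : ℕ} (hM : f.totalDegree < M)
    {t H : ℕ → ℝ} (ht0 : ∀ k, t k ≠ 0) (ht : Tendsto t atTop (𝓝 0))
    (hH : ∀ N : ℕ, ∃ c, ∀ᶠ k in atTop, |t k * H k ^ N| ≤ c) {x : ℕ → σ → ℝ}
    (hx : ∀ k i, eval (x k) (pderiv i (penalty f M (t k))) = 0) (hxH : ∀ k i, x k i ^ 2 ≤ H k)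
    (hf : ∀ k, (eval (x k) f - t k) ^ 2 ≤ t k ^ 4 * H k) :
    ∃ k i, t k ^ 2 * H k < eval (x k) (pderiv i f) ^ 2 := by
  have hT0 : ofSeq t ≠ 0 := left_ne_zero_of_mul_eq_one (b := ofSeq fun k => (t k)⁻¹)
    (congrArg ofSeq (funext fun k => mul_inv_cancel₀ (ht0 k)))
  have hT : 0 < mk (ofSeq t) := Hyperreal.archimedeanClassMk_pos_of_tendsto
    (Hyperreal.tendsto_ofSeq.2 (ht.mono_left Nat.hyperfilter_le_atTop))
  obtain ⟨i, hi⟩ := exists_lt_sq_aeval_pderiv (H := ofSeq H) hT0 hT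
    (fun N => (hH N).elim fun _ hc => mk_ofSeq_nonneg hc) f
    (isIntegral_ofSeq_of_eval_pderiv_penalty_eq_zero hM hT0 hx)
    (fun i => ofSeq_le_ofSeq.2 (.of_forall fun k => hxH k i))
    (by rw [aeval_ofSeq]; exact ofSeq_le_ofSeq.2 (.of_forall hf))
  rw [aeval_ofSeq] at hi
  obtain ⟨k, hk⟩ := (Hyperreal.ofSeq_lt_ofSeq.1 hi).exists
  exact ⟨k, i, hk⟩

end Hyperreal

theorem mul_add_pow_le_of_mul_pow_succ_le_one {t u B : ℝ} (ht0 : 0 ≤ t) (ht1 : t ≤ 1) (hu : 0 ≤ u)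
    (hB : 1 ≤ B) {N k : ℕ} (hN : N ≤ k) (h : t * u ^ (k + 1) ≤ 1) :
    t * (u + B) ^ N ≤ (2 * B) ^ N := by
  rcases le_total u B with huB | hBu
  · calc t * (u + B) ^ N ≤ 1 * (2 * B) ^ N := by gcongr; linarith
      _ = (2 * B) ^ N := one_mul _
  · calc t * (u + B) ^ N ≤ t * (2 * u) ^ N := by gcongr; linarith
      _ = 2 ^ N * (t * u ^ N) := by ring
      _ ≤ 2 ^ N * (t * u ^ (k + 1)) := by gcongr <;> [linarith; omega]
      _ ≤ 2 ^ N * 1 := by gcongr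
      _ ≤ 2 ^ N * B ^ N := by gcongr; exact one_le_pow₀ hB
      _ = (2 * B) ^ N := (mul_pow 2 B N).symm

theorem exists_forall_mem_sum_pow_le {S : Set (σ → ℝ)} (hS : Bornology.IsBounded S) (M : ℕ) :
    ∃ B : ℝ, 1 ≤ B ∧ ∀ y ∈ S, ∑ i, y i ^ (2 * M) ≤ B := by
  obtain ⟨r, hr⟩ := hS.exists_norm_le
  refine ⟨max 1 (∑ _i : σ, r ^ (2 * M)), le_max_left _ _, fun y hy => le_max_of_le_right ?_⟩
  refine Finset.sum_le_sum fun i _ => ?_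
  rw [← (even_two_mul M).pow_abs]
  exact pow_le_pow_left₀ (abs_nonneg _) ((norm_le_pi_norm y i).trans (hr y hy)) _

open Filter Topology in
/- A sequence of counterexamples with `N → ∞` is a hyperreal counterexample in which the squared
gradient, divided by `t ^ 2`, is smaller than every fractional power of `t⁻¹`. -/
theorem exists_abs_pow_le_gradNormSq_pow (f : MvPolynomial σ ℝ) {S : Set (σ → ℝ)}
    (hS : Bornology.IsBounded S) : ∃ N : ℕ, ∃ δ : ℝ, 0 < δ ∧ ∀ y ∈ S, |eval y f| < δ →
      |eval y f| ^ (2 * N + 1) ≤ eval y (gradNormSq f) ^ (N + 1) := by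
  by_contra! hcon
  choose y hyS hyt hy using fun k : ℕ => hcon k (1 / (k + 1)) Nat.one_div_pos_of_nat
  set t : ℕ → ℝ := fun k => eval (y k) f
  set u : ℕ → ℝ := fun k => eval (y k) (gradNormSq f) / t k ^ 2
  obtain ⟨B, hB1, hB⟩ := exists_forall_mem_sum_pow_le hS (f.totalDegree + 1)
  have hG (k : ℕ) : 0 ≤ eval (y k) (gradNormSq f) := by
    rw [eval_gradNormSq]
    positivity
  have hu (k : ℕ) : 0 ≤ u k := div_nonneg (hG k) (sq_nonneg _)
  have ht0 (k : ℕ) : t k ≠ 0 := fun h => by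
    have := (pow_nonneg (hG k) (k + 1)).trans_lt (hy k)
    simp [t, h] at this
  have ht1 (k : ℕ) : |t k| ≤ 1 :=
    (hyt k).le.trans (div_le_one_of_le₀ (le_add_of_nonneg_left k.cast_nonneg) (by positivity))
  have ht : Tendsto t atTop (𝓝 0) :=
    squeeze_zero_norm (fun k => (hyt k).le) tendsto_one_div_add_atTop_nhds_zero_nat
  have htu (k : ℕ) : |t k| * u k ^ (k + 1) ≤ 1 := by
    rw [div_pow, ← sq_abs, ← mul_div_assoc, div_le_one (by have := abs_pos.2 (ht0 k); positivity)]
    calc |t k| * eval (y k) (gradNormSq f) ^ (k + 1) ≤ |t k| * |t k| ^ (2 * k + 1) := by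
          gcongr
          exact (hy k).le
      _ = (|t k| ^ 2) ^ (k + 1) := by ring
  choose x hx hxH hf hgrad using fun k =>
    exists_eval_pderiv_penalty_eq_zero f f.totalDegree.succ_ne_zero (ht0 k) rfl
      (H := u k + B) (hB1.trans (le_add_of_nonneg_left (hu k))) <| by
        rw [mul_add, mul_div_cancel₀ _ (pow_ne_zero 2 (ht0 k))]
        gcongr
        exact hB _ (hyS k)
  have hsub (N : ℕ) : ∃ c, ∀ᶠ k in atTop, |t k * (u k + B) ^ N| ≤ c := by
    refine ⟨(2 * B) ^ N, (eventually_ge_atTop N).mono fun k hk => ?_⟩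
    have hHk : 0 ≤ u k + B := by linarith [hu k]
    rw [abs_mul, abs_of_nonneg (pow_nonneg hHk N)]
    exact mul_add_pow_le_of_mul_pow_succ_le_one (abs_nonneg _) (ht1 k) (hu k) hB1 hk (htu k)
  obtain ⟨k, i, hki⟩ :=
    exists_lt_sq_eval_pderiv f f.totalDegree.lt_succ_self ht0 ht hsub hx hxH hf
  exact (hgrad k i).not_gt hki

end GradientInequality

section Sphere

open MvPolynomial

variable {σ : Type*} [Fintype σ]

/-- The polynomial `f` modified off the unit sphere so that its gradient at a point of the sphere
is the tangential part of the gradient of `f`. -/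
def sphereExtension (f : MvPolynomial σ ℝ) : MvPolynomial σ ℝ :=
  f - C (1 / 2) * (∑ j, X j * pderiv j f) * (∑ j, X j ^ 2 - 1)

variable {y : σ → ℝ}

theorem eval_sphereExtension (f : MvPolynomial σ ℝ) (hy : ∑ j, y j ^ 2 = 1) :
    eval y (sphereExtension f) = eval y f := by
  simp [sphereExtension, hy]

theorem eval_pderiv_sphereExtension (f : MvPolynomial σ ℝ) (hy : ∑ j, y j ^ 2 = 1) (i : σ) :
    eval y (pderiv i (sphereExtension f)) =
      eval y (pderiv i f) - (∑ j, y j * eval y (pderiv j f)) * y i := by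
  classical
  have hsq : pderiv i (∑ j, X j ^ 2 - 1 : MvPolynomial σ ℝ) = 2 * X i := by
    simp [pderiv_X, Pi.single_apply]
  rw [sphereExtension, map_sub, Derivation.leibniz, hsq]
  simp only [smul_eq_mul, map_sub, map_add, map_mul, map_sum, map_pow, map_ofNat, map_one, eval_C,
    eval_X, hy]
  ring

theorem exists_abs_pow_le_tangential_gradient_pow (f : MvPolynomial σ ℝ) :
    ∃ N : ℕ, ∃ δ : ℝ, 0 < δ ∧ ∀ y : σ → ℝ, ∑ j, y j ^ 2 = 1 → |eval y f| < δ →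
      |eval y f| ^ (2 * N + 1) ≤
        (∑ i, (eval y (pderiv i f) - (∑ j, y j * eval y (pderiv j f)) * y i) ^ 2) ^ (N + 1) := by
  have hbounded : Bornology.IsBounded {y : σ → ℝ | ∑ j, y j ^ 2 = 1} := by
    refine (Metric.isBounded_closedBall (x := 0) (r := 1)).subset fun y hy => ?_
    rw [mem_closedBall_zero_iff, pi_norm_le_iff_of_nonneg zero_le_one]
    intro i
    rw [Real.norm_eq_abs, ← sq_le_one_iff_abs_le_one, ← Set.mem_ofPred.1 hy]
    exact Finset.single_le_sum (fun j _ => sq_nonneg (y j)) (Finset.mem_univ i)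
  obtain ⟨N, δ, hδ, h⟩ := exists_abs_pow_le_gradNormSq_pow (sphereExtension f) hbounded
  refine ⟨N, δ, hδ, fun y hy hlt => ?_⟩
  have := h y hy (by rwa [eval_sphereExtension f hy])
  simpa only [eval_sphereExtension f hy, eval_gradNormSq,
    eval_pderiv_sphereExtension f hy] using this

end Sphere

section Descent

open Filter Topology

theorem exists_tendsto_of_dist_le_sub {X : Type*} [PseudoMetricSpace X] [CompleteSpace X]
    {x : ℕ → X} {u : ℕ → ℝ} (hu : ∀ k, 0 ≤ u k)
    (h : ∀ k, dist (x k) (x (k + 1)) ≤ u k - u (k + 1)) : ∃ z, Tendsto x atTop (𝓝 z) := by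
  refine cauchySeq_tendsto_of_complete (cauchySeq_of_summable_dist ?_)
  refine summable_of_sum_range_le (c := u 0) (fun _ => dist_nonneg) fun N => ?_
  calc ∑ k ∈ Finset.range N, dist (x k) (x (k + 1))
      ≤ ∑ k ∈ Finset.range N, (u k - u (k + 1)) := Finset.sum_le_sum fun k _ => h k
    _ = u 0 - u N := Finset.sum_range_sub' u N
    _ ≤ u 0 := sub_le_self _ (hu N)

theorem mul_sub_le_rpow_mul_rpow_sub_rpow {s t p : ℝ} (hs : 0 ≤ s) (hst : s ≤ t) (hp0 : 0 ≤ p)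
    (hp1 : p ≤ 1) : p * (t - s) ≤ t ^ (1 - p) * (t ^ p - s ^ p) := by
  rcases (hs.trans hst).eq_or_lt with rfl | ht
  · simp [le_antisymm hst hs]
  have hsplit : t ^ (1 - p) * t ^ p = t := by
    rw [← Real.rpow_add ht, sub_add_cancel, Real.rpow_one]
  have bernoulli : (s / t) ^ p ≤ 1 + p * (s / t - 1) := by
    simpa using rpow_one_add_le_one_add_mul_self (s := s / t - 1)
      (by linarith [div_nonneg hs ht.le]) hp0 hp1
  calc p * (t - s) = t * (1 - (1 + p * (s / t - 1))) := by field_simp; ring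
    _ ≤ t * (1 - (s / t) ^ p) := by gcongr
    _ = t ^ (1 - p) * t ^ p * (1 - (s / t) ^ p) := by rw [hsplit]
    _ = t ^ (1 - p) * (t ^ p - s ^ p) := by
      rw [Real.div_rpow hs ht.le, mul_assoc, mul_sub, mul_one, mul_div_cancel₀ _ (by positivity)]

/- By concavity of `t ↦ t ^ (1 - θ)`, the two hypotheses bound the length of each step by a multiple
of the decrease of `t k ^ (1 - θ)`. -/
theorem exists_tendsto_of_lojasiewicz {X : Type*} [PseudoMetricSpace X] [CompleteSpace X]
    {x : ℕ → X} {t : ℕ → ℝ} (ht : ∀ k, 0 ≤ t k) {c C θ : ℝ} (hc : 0 < c) (hC : 0 ≤ C) (hθ0 : 0 ≤ θ)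
    (hθ1 : θ < 1) (hdesc : ∀ k, c * dist (x k) (x (k + 1)) ^ 2 ≤ t k - t (k + 1))
    (hloj : ∀ᶠ k in atTop, t k ^ θ ≤ C * dist (x k) (x (k + 1))) :
    ∃ z, Tendsto x atTop (𝓝 z) := by
  obtain ⟨k₀, hk₀⟩ := eventually_atTop.1 hloj
  suffices ∃ z, Tendsto (fun k => x (k + k₀)) atTop (𝓝 z) from
    this.imp fun z => (tendsto_add_atTop_iff_nat k₀).1
  have hp : 0 < c * (1 - θ) := mul_pos hc (sub_pos.2 hθ1)
  refine exists_tendsto_of_dist_le_sub (u := fun k => C / (c * (1 - θ)) * t (k + k₀) ^ (1 - θ))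
    (fun k => mul_nonneg (div_nonneg hC hp.le) (Real.rpow_nonneg (ht _) _)) fun k => ?_
  rw [← mul_sub, add_right_comm, div_mul_eq_mul_div, le_div_iff₀ hp]
  set j := k + k₀
  set d := dist (x j) (x (j + 1))
  have hanti : t (j + 1) ≤ t j := sub_nonneg.1 ((by positivity : 0 ≤ c * d ^ 2).trans (hdesc j))
  have hmono : 0 ≤ t j ^ (1 - θ) - t (j + 1) ^ (1 - θ) :=
    sub_nonneg.2 (Real.rpow_le_rpow (ht _) hanti (by linarith))
  have hd0 : 0 ≤ d := dist_nonneg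
  rcases hd0.eq_or_lt with hd | hd
  · rw [← hd, zero_mul]
    exact mul_nonneg hC hmono
  refine le_of_mul_le_mul_right ?_ hd
  calc d * (c * (1 - θ)) * d = (1 - θ) * (c * d ^ 2) := by ring
    _ ≤ (1 - θ) * (t j - t (j + 1)) :=
      mul_le_mul_of_nonneg_left (hdesc j) (by linarith)
    _ ≤ t j ^ θ * (t j ^ (1 - θ) - t (j + 1) ^ (1 - θ)) := by
      simpa using mul_sub_le_rpow_mul_rpow_sub_rpow (ht (j + 1)) hanti
        (by linarith : 0 ≤ 1 - θ) (by linarith)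
    _ ≤ C * d * (t j ^ (1 - θ) - t (j + 1) ^ (1 - θ)) := by
      gcongr
      exact hk₀ j (Nat.le_add_left _ _)
    _ = C * (t j ^ (1 - θ) - t (j + 1) ^ (1 - θ)) * d := by ring

end Descent

section Contraction

variable {m n : ℕ} {A : Tensor m n}

theorem contract_self (A : Tensor m n) (x : EuclideanSpace ℝ (Fin n)) : contract m A x = A := by
  have : IsEmpty (Fin (m - m)) := by rw [Nat.sub_self]; infer_instance
  funext i
  have hi (j : Fin (m - m) → Fin n) : joinIndex m i j = i := funext fun t => dif_pos t.isLt
  simp [contract, hi]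

theorem joinIndex_snoc {r : ℕ} (hr : r < m) (i : Fin r → Fin n) (l : Fin n)
    (j : Fin (m - (r + 1)) → Fin n) :
    joinIndex (m := m) (r + 1) (Fin.snoc i l) j =
      joinIndex r i fun t => (Fin.cons l j : Fin (m - (r + 1) + 1) → Fin n)
        (t.cast (by omega)) := by
  funext t
  unfold joinIndex
  rcases lt_trichotomy (t : ℕ) r with h | h | h
  · rw [dif_pos (Nat.lt_succ_of_lt h), dif_pos h]
    exact Fin.snoc_castSucc (α := fun _ => Fin n) l i ⟨t, h⟩
  · have hlast : (⟨t, by omega⟩ : Fin (r + 1)) = Fin.last r := Fin.ext h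
    have hzero : (⟨(t : ℕ) - r, by omega⟩ : Fin (m - r)).cast (by omega) =
      (0 : Fin (m - (r + 1) + 1)) := Fin.ext (by simp [h])
    rw [dif_pos (by omega), dif_neg (by omega), hlast, Fin.snoc_last]
    exact (congrArg (Fin.cons l j : Fin (m - (r + 1) + 1) → Fin n) hzero).symm
  · have hsucc : (⟨(t : ℕ) - r, by omega⟩ : Fin (m - r)).cast (by omega) =
      (⟨(t : ℕ) - (r + 1), by omega⟩ : Fin (m - (r + 1))).succ := Fin.ext (by simp; omega)
    rw [dif_neg (by omega), dif_neg (by omega)]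
    exact (congrArg (Fin.cons l j : Fin (m - (r + 1) + 1) → Fin n) hsucc).symm

theorem contract_eq_sum_snoc {r : ℕ} (hr : r < m) (A : Tensor m n) (x : EuclideanSpace ℝ (Fin n))
    (i : Fin r → Fin n) :
    contract r A x i = ∑ l, contract (r + 1) A x (Fin.snoc i l) * x l := by
  have hlen : m - (r + 1) + 1 = m - r := by omega
  simp only [contract, Finset.sum_mul]
  rw [← Fintype.sum_prod_type']
  refine (Fintype.sum_equiv ((Fin.consEquiv fun _ => Fin n).trans
    (Equiv.arrowCongr (finCongr hlen) (Equiv.refl _))) _ _ ?_).symm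
  rintro ⟨l, j⟩
  rw [joinIndex_snoc hr, ← (finCongr hlen).prod_comp, Fin.prod_univ_succ]
  simp only [Equiv.arrowCongr, Equiv.coe_refl, Equiv.refl_symm, finCongr_symm, finCongr_apply,
    Function.comp_def, id_eq, Equiv.trans_apply, Equiv.coe_fn_mk, Fin.consEquiv_apply,
    Fin.cast_cast, Fin.cast_eq_self, Fin.cons_zero, Fin.cons_succ]
  ring

theorem joinIndex_comp_viaFintypeEmbedding {r : ℕ} (hr : r ≤ m) (τ : Equiv.Perm (Fin r))
    (i : Fin r → Fin n) (j : Fin (m - r) → Fin n) :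
    joinIndex r i j ∘ τ.viaFintypeEmbedding (Fin.castLEEmb hr) = joinIndex r (i ∘ τ) j := by
  funext t
  by_cases ht : (t : ℕ) < r
  · obtain ⟨s, rfl⟩ : ∃ s, t = Fin.castLEEmb hr s := ⟨⟨t, ht⟩, rfl⟩
    rw [Function.comp_apply, Equiv.Perm.viaFintypeEmbedding_apply_image]
    simp [joinIndex]
  · rw [Function.comp_apply, Equiv.Perm.viaFintypeEmbedding_apply_notMem_range]
    · simp [joinIndex, ht]
    · rintro ⟨s, rfl⟩
      exact ht s.isLt

theorem isSymmetric_contract (hA : IsSymmetric A) {r : ℕ} (hr : r ≤ m)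
    (x : EuclideanSpace ℝ (Fin n)) : IsSymmetric (contract r A x) := fun τ i =>
  Finset.sum_congr rfl fun j _ => by rw [← joinIndex_comp_viaFintypeEmbedding hr τ, hA]

theorem IsSymmetric.apply_snoc_snoc {r : ℕ} {T : Tensor (r + 2) n} (hT : IsSymmetric T)
    (i : Fin r → Fin n) (l l' : Fin n) :
    T (Fin.snoc (Fin.snoc i l : Fin (r + 1) → Fin n) l') =
      T (Fin.snoc (Fin.snoc i l' : Fin (r + 1) → Fin n) l) := by
  rw [← hT (Equiv.swap (Fin.last r).castSucc (Fin.last (r + 1)))]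
  congr 1
  funext t
  induction t using Fin.lastCases with
  | last => simp
  | cast t =>
    induction t using Fin.lastCases with
    | last => simp
    | cast t =>
      rw [Function.comp_apply, Equiv.swap_apply_of_ne_of_ne
        (Fin.castSucc_injective _ |>.ne t.castSucc_lt_last.ne) (Fin.castSucc_lt_last _).ne]
      simp

theorem hasDerivAt_contract (hA : IsSymmetric A) (x v : EuclideanSpace ℝ (Fin n)) (s : ℝ) {r : ℕ}
    (hr : r ≤ m) (i : Fin r → Fin n) :
    HasDerivAt (fun s : ℝ => contract r A (x + s • v) i)
      (((m : ℝ) - r) * ∑ l, contract (r + 1) A (x + s • v) (Fin.snoc i l) * v l) s := by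
  induction hr using Nat.decreasingInduction with
  | self => simpa [contract_self] using hasDerivAt_const s (A i)
  | of_succ r hr ih =>
    simp_rw [contract_eq_sum_snoc hr]
    have hcoord (l : Fin n) : HasDerivAt (fun s : ℝ => (x + s • v) l) (v l) s := by
      simpa using ((hasDerivAt_id s).mul_const (v l)).const_add (x l)
    refine (HasDerivAt.fun_sum fun l _ => (ih (Fin.snoc i l)).mul (hcoord l)).congr_deriv ?_
    have hsucc (hr : r + 1 < m) : ∑ l, (∑ l', contract (r + 1 + 1) A (x + s • v)
        (Fin.snoc (Fin.snoc i l : Fin (r + 1) → Fin n) l') * v l') * (x + s • v) l =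
          ∑ l, contract (r + 1) A (x + s • v) (Fin.snoc i l) * v l := by
      simp_rw [contract_eq_sum_snoc hr, Finset.sum_mul]
      rw [Finset.sum_comm]
      refine Finset.sum_congr rfl fun l' _ => Finset.sum_congr rfl fun l _ => ?_
      rw [(isSymmetric_contract hA hr _).apply_snoc_snoc, mul_right_comm]
    rw [Finset.sum_add_distrib]
    simp_rw [mul_assoc, ← Finset.mul_sum]
    rcases (Nat.succ_le_of_lt hr).eq_or_lt with rfl | hr'
    · simp
    · rw [hsucc hr']
      push_cast
      ring

theorem contract_smul_vec (r : ℕ) (A : Tensor m n) (c : ℝ) (x : EuclideanSpace ℝ (Fin n)) :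
    contract r A (c • x) = c ^ (m - r) • contract r A x := by
  funext i
  simp [contract, Finset.prod_mul_distrib, Finset.mul_sum, mul_left_comm]

theorem contract_add (r : ℕ) (A B : Tensor m n) (x : EuclideanSpace ℝ (Fin n)) :
    contract r (A + B) x = contract r A x + contract r B x := by
  funext i
  simp [contract, add_mul, Finset.sum_add_distrib]

theorem contract_smul (r : ℕ) (c : ℝ) (A : Tensor m n) (x : EuclideanSpace ℝ (Fin n)) :
    contract r (c • A) x = c • contract r A x := by
  funext i
  simp [contract, mul_assoc, Finset.mul_sum]

theorem continuous_contract (r : ℕ) (A : Tensor m n) (i : Fin r → Fin n) :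
    Continuous fun x => contract r A x i := by
  unfold contract
  fun_prop

theorem continuous_rayleigh (A : Tensor m n) : Continuous (rayleigh A) :=
  continuous_contract 0 A ![]

theorem continuous_contractVec (A : Tensor m n) : Continuous (contractVec A) :=
  (PiLp.continuous_toLp 2 _).comp (continuous_pi fun i => continuous_contract 1 A ![i])

theorem continuous_contractMat (A : Tensor m n) : Continuous (contractMat A) :=
  continuous_matrix fun i j => continuous_contract 2 A ![i, j]

theorem contractMat_smul_vec (A : Tensor m n) (c : ℝ) (x : EuclideanSpace ℝ (Fin n)) :
    contractMat A (c • x) = c ^ (m - 2) • contractMat A x := by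
  ext k l
  simp [contractMat, contract_smul_vec]

theorem contractMat_add (A B : Tensor m n) (x : EuclideanSpace ℝ (Fin n)) :
    contractMat (A + B) x = contractMat A x + contractMat B x := by
  ext k l
  simp [contractMat, contract_add]

theorem contractMat_smul (c : ℝ) (A : Tensor m n) (x : EuclideanSpace ℝ (Fin n)) :
    contractMat (c • A) x = c • contractMat A x := by
  ext k l
  simp [contractMat, contract_smul]

theorem snoc_vecEmpty (l : Fin n) : (Fin.snoc ![] l : Fin 1 → Fin n) = ![l] := by
  funext t
  fin_cases t
  rfl

theorem snoc_vecSingle (k l : Fin n) : (Fin.snoc ![k] l : Fin 2 → Fin n) = ![k, l] := by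
  funext t
  fin_cases t <;> rfl

theorem inner_contractVec (A : Tensor m n) (x v : EuclideanSpace ℝ (Fin n)) :
    inner ℝ (contractVec A x) v = ∑ l, contract 1 A x ![l] * v l := by
  simp [PiLp.inner_apply, contractVec, mul_comm]

theorem rayleigh_eq_inner (hm : 1 ≤ m) (A : Tensor m n) (x : EuclideanSpace ℝ (Fin n)) :
    rayleigh A x = inner ℝ (contractVec A x) x := by
  rw [rayleigh, contract_eq_sum_snoc hm, inner_contractVec]
  simp only [snoc_vecEmpty]

theorem ofLp_contractVec (hm : 2 ≤ m) (A : Tensor m n) (x : EuclideanSpace ℝ (Fin n)) :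
    (contractVec A x).ofLp = (contractMat A x).mulVec x := by
  funext k
  simp only [contractVec, contract_eq_sum_snoc hm, snoc_vecSingle]
  rfl

theorem isHermitian_contractMat (hm : 2 ≤ m) (hA : IsSymmetric A)
    (x : EuclideanSpace ℝ (Fin n)) : (contractMat A x).IsHermitian :=
  Matrix.IsHermitian.ext fun k l => by
    simpa only [contractMat, Matrix.of_apply, star_trivial, snoc_vecEmpty, snoc_vecSingle] using
      (isSymmetric_contract hA hm x).apply_snoc_snoc (r := 0) ![] l k

theorem hasDerivAt_rayleigh (hA : IsSymmetric A) (x v : EuclideanSpace ℝ (Fin n)) (s : ℝ) :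
    HasDerivAt (fun s : ℝ => rayleigh A (x + s • v))
      (m * inner ℝ (contractVec A (x + s • v)) v) s := by
  refine (hasDerivAt_contract hA x v s (Nat.zero_le m) ![]).congr_deriv ?_
  simp only [inner_contractVec, snoc_vecEmpty, Nat.cast_zero, sub_zero]

theorem hasDerivAt_inner_contractVec (hm : 1 ≤ m) (hA : IsSymmetric A)
    (x v : EuclideanSpace ℝ (Fin n)) (s : ℝ) :
    HasDerivAt (fun s : ℝ => inner ℝ (contractVec A (x + s • v)) v)
      (((m : ℝ) - 1) * v.ofLp ⬝ᵥ (contractMat A (x + s • v)).mulVec v) s := by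
  simp_rw [inner_contractVec]
  refine (HasDerivAt.fun_sum fun k _ =>
    (hasDerivAt_contract hA x v s hm ![k]).mul_const (v k)).congr_deriv ?_
  simp only [snoc_vecSingle, dotProduct, Matrix.mulVec, contractMat, Matrix.of_apply,
    Nat.cast_one, Finset.mul_sum, mul_comm, mul_left_comm]

/-- The homogeneous polynomial `A x^m` in the coordinates of `x`. -/
def rayleighPoly (A : Tensor m n) : MvPolynomial (Fin n) ℝ :=
  ∑ i : Fin m → Fin n, MvPolynomial.C (A i) * ∏ t, MvPolynomial.X (i t)

theorem eval_rayleighPoly (A : Tensor m n) (x : EuclideanSpace ℝ (Fin n)) :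
    MvPolynomial.eval x (rayleighPoly A) = rayleigh A x := by
  simp only [rayleighPoly, map_sum, map_mul, MvPolynomial.eval_C, map_prod, MvPolynomial.eval_X]
  rfl

theorem eval_pderiv_rayleighPoly (hA : IsSymmetric A) (x : EuclideanSpace ℝ (Fin n)) (j : Fin n) :
    MvPolynomial.eval x (MvPolynomial.pderiv j (rayleighPoly A)) = m * contractVec A x j := by
  have hpoly := hasDerivAt_eval_add_mul (rayleighPoly A) x (EuclideanSpace.single j 1) 0
  have hray := hasDerivAt_rayleigh hA x (EuclideanSpace.single j 1) 0
  simp_rw [← eval_rayleighPoly] at hray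
  simpa [Pi.single_apply, EuclideanSpace.inner_single_right] using hpoly.unique hray

end Contraction

section SpectralBound

variable {ι : Type*} [Fintype ι] [DecidableEq ι]

theorem spectralRadius_le_sum_nnnorm (M : Matrix ι ι ℝ) :
    spectralRadius ℝ M ≤ (∑ i, ∑ j, ‖M i j‖₊ : NNReal) := by
  cases isEmpty_or_nonempty ι
  · simp [Subsingleton.elim M 0]
  let _ := Matrix.linftyOpNormedRing (n := ι) (α := ℝ)
  let _ := Matrix.linftyOpNormedAlgebra (n := ι) (R := ℝ) (α := ℝ)
  refine (spectrum.spectralRadius_le_nnnorm (𝕜 := ℝ) M).trans (ENNReal.coe_le_coe.2 ?_)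
  rw [Matrix.linfty_opNNNorm_def]
  exact Finset.sup_le fun i hi =>
    Finset.single_le_sum (f := fun i => ∑ j, ‖M i j‖₊) (fun _ _ => zero_le) hi

theorem toReal_spectralRadius_le_sum_norm (M : Matrix ι ι ℝ) :
    (spectralRadius ℝ M).toReal ≤ ∑ i, ∑ j, ‖M i j‖ := by
  simpa only [ENNReal.coe_toReal, NNReal.coe_sum, coe_nnnorm] using
    ENNReal.toReal_mono ENNReal.coe_ne_top (spectralRadius_le_sum_nnnorm M)

theorem posSemidef_add_spectralRadius_smul_one {M : Matrix ι ι ℝ} (hM : M.IsHermitian) :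
    (M + (spectralRadius ℝ M).toReal • (1 : Matrix ι ι ℝ)).PosSemidef := by
  rw [Matrix.posSemidef_iff_isHermitian_and_spectrum_nonneg, ← Algebra.algebraMap_eq_smul_one,
    ← spectrum.add_singleton_eq, Algebra.algebraMap_eq_smul_one]
  refine ⟨hM.add (Matrix.isHermitian_one.smul (IsSelfAdjoint.all _)), ?_⟩
  rintro _ ⟨μ, hμ, _, rfl, rfl⟩
  have hle : (‖μ‖₊ : ENNReal) ≤ spectralRadius ℝ M :=
    le_iSup₂ (f := fun k (_ : k ∈ spectrum ℝ M) => (‖k‖₊ : ENNReal)) μ hμ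
  have habs : |μ| ≤ (spectralRadius ℝ M).toReal := by
    simpa using ENNReal.toReal_mono
      (ne_top_of_le_ne_top ENNReal.coe_ne_top (spectralRadius_le_sum_nnnorm M)) hle
  exact neg_le_iff_add_nonneg.1 (neg_le_of_abs_le habs)

variable {m n : ℕ}

theorem mul_spectralRadius_contractMat_le_beta (hm : 1 ≤ m) (E : Tensor m n)
    {x : EuclideanSpace ℝ (Fin n)} (hx : ‖x‖ = 1) :
    ((m : ℝ) - 1) * (spectralRadius ℝ (contractMat E x)).toReal ≤ beta E := by
  have hm' : (1 : ℝ) ≤ m := by exact_mod_cast hm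
  refine mul_le_mul_of_nonneg_left (le_csSup ?_ ⟨x, by simpa using hx, rfl⟩) (by linarith)
  have hcont : Continuous fun x => ∑ i, ∑ j, ‖contractMat E x i j‖ := by
    have := continuous_contractMat E
    fun_prop
  obtain ⟨C, hC⟩ := (isCompact_sphere (0 : EuclideanSpace ℝ (Fin n)) 1).bddAbove_image
    hcont.continuousOn
  refine ⟨C, ?_⟩
  rintro _ ⟨y, hy, rfl⟩
  exact (toReal_spectralRadius_le_sum_norm _).trans (hC ⟨y, hy, rfl⟩)

theorem beta_nonneg (hm : 1 ≤ m) (E : Tensor m n) : 0 ≤ beta E := by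
  have hm' : (1 : ℝ) ≤ m := by exact_mod_cast hm
  refine mul_nonneg (by linarith) (Real.sSup_nonneg ?_)
  rintro _ ⟨x, _, rfl⟩
  exact ENNReal.toReal_nonneg

variable {E : Tensor m n} {x : EuclideanSpace ℝ (Fin n)}

theorem posSemidef_contractMat_add_beta_of_norm_eq_one (hm : 2 ≤ m) (hE : IsSymmetric E)
    (hx : ‖x‖ = 1) :
    (((m : ℝ) - 1) • contractMat E x + beta E • (1 : Matrix (Fin n) (Fin n) ℝ)).PosSemidef := by
  have hm' : (2 : ℝ) ≤ m := by exact_mod_cast hm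
  have hsplit := ((posSemidef_add_spectralRadius_smul_one (isHermitian_contractMat hm hE x)).smul
    (by linarith : (0 : ℝ) ≤ m - 1)).add (Matrix.PosSemidef.one.smul
      (sub_nonneg.2 (mul_spectralRadius_contractMat_le_beta (by omega) E hx)))
  convert hsplit using 1
  module

theorem posSemidef_contractMat_add_beta (hm : 2 ≤ m) (hE : IsSymmetric E) (hx : ‖x‖ ≤ 1) :
    (((m : ℝ) - 1) • contractMat E x + beta E • (1 : Matrix (Fin n) (Fin n) ℝ)).PosSemidef := by
  cases isEmpty_or_nonempty (Fin n)
  · rw [Subsingleton.elim (_ + _) (0 : Matrix (Fin n) (Fin n) ℝ)]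
    exact Matrix.PosSemidef.zero
  obtain ⟨u, hu, hxu⟩ : ∃ u : EuclideanSpace ℝ (Fin n), ‖u‖ = 1 ∧ x = ‖x‖ • u := by
    rcases eq_or_ne x 0 with rfl | hx0
    · obtain ⟨u, hu⟩ := exists_norm_eq (EuclideanSpace ℝ (Fin n)) zero_le_one
      exact ⟨u, hu, by simp⟩
    · exact ⟨‖x‖⁻¹ • x, norm_smul_inv_norm hx0,
        (smul_inv_smul₀ (norm_ne_zero_iff.2 hx0) x).symm⟩
  have hconvex := ((posSemidef_contractMat_add_beta_of_norm_eq_one hm hE hu).smul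
    (pow_nonneg (norm_nonneg x) (m - 2))).add (Matrix.PosSemidef.one.smul (mul_nonneg
      (sub_nonneg.2 (pow_le_one₀ (norm_nonneg x) hx : ‖x‖ ^ (m - 2) ≤ 1))
      (beta_nonneg (by omega) E)))
  convert hconvex using 1
  conv_lhs => rw [hxu, contractMat_smul_vec]
  module

end SpectralBound

section RankOne

variable {m n : ℕ}

theorem isSymmetric_rankOne (a : EuclideanSpace ℝ (Fin n)) : IsSymmetric (rankOne m a) :=
  fun σ i => Equiv.prod_comp σ fun t => a (i t)

theorem IsSymmetric.add {A B : Tensor m n} (hA : IsSymmetric A) (hB : IsSymmetric B) :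
    IsSymmetric (A + B) :=
  fun σ i => congrArg₂ (· + ·) (hA σ i) (hB σ i)

theorem IsSymmetric.smul {A : Tensor m n} (hA : IsSymmetric A) (c : ℝ) : IsSymmetric (c • A) :=
  fun σ i => congrArg (c • ·) (hA σ i)

theorem contract_rankOne (a x : EuclideanSpace ℝ (Fin n)) {r : ℕ} (hr : r ≤ m)
    (i : Fin r → Fin n) :
    contract r (rankOne m a) x i = inner ℝ a x ^ (m - r) * ∏ s, a (i s) := by
  induction hr using Nat.decreasingInduction with
  | self => simp [contract_self, rankOne]
  | of_succ r hr ih =>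
    have hinner : (inner ℝ a x : ℝ) = ∑ l, a l * x l := by simp [PiLp.inner_apply, mul_comm]
    calc contract r (rankOne m a) x i
        = ∑ l, inner ℝ a x ^ (m - (r + 1)) * ((∏ s, a (i s)) * a l) * x l := by
          simp [contract_eq_sum_snoc hr, ih, Fin.prod_univ_castSucc]
      _ = inner ℝ a x ^ (m - (r + 1)) * (∏ s, a (i s)) * inner ℝ a x := by
          rw [hinner, Finset.mul_sum]
          exact Finset.sum_congr rfl fun l _ => by ring
      _ = inner ℝ a x ^ (m - r) * ∏ s, a (i s) := by
          rw [show m - r = m - (r + 1) + 1 by omega]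
          ring

theorem contractMat_rankOne (hm : 2 ≤ m) (a x : EuclideanSpace ℝ (Fin n)) :
    contractMat (rankOne m a) x = inner ℝ a x ^ (m - 2) • Matrix.vecMulVec a a := by
  ext k l
  simp [contractMat, contract_rankOne a x hm, Matrix.vecMulVec_apply]

theorem posSemidef_contractMat_rankOne (hm : 2 ≤ m) (hm_even : Even m)
    (a x : EuclideanSpace ℝ (Fin n)) : (contractMat (rankOne m a) x).PosSemidef := by
  rw [contractMat_rankOne hm]
  exact (Matrix.posSemidef_vecMulVec_self_star a.ofLp).smul
    ((hm_even.tsub even_two).pow_nonneg _)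

end RankOne

section Ascent

theorem add_sq_le_of_le_deriv2 {φ φ' φ'' : ℝ → ℝ} {a b c : ℝ} (hab : a < b)
    (hφ : ∀ s ∈ Set.Icc a b, HasDerivAt φ (φ' s) s)
    (hφ' : ∀ s ∈ Set.Icc a b, HasDerivAt φ' (φ'' s) s) (hc : ∀ s ∈ Set.Icc a b, c ≤ φ'' s) :
    φ a + φ' a * (b - a) + c / 2 * (b - a) ^ 2 ≤ φ b := by
  have hψ (s) (hs : s ∈ Set.Icc a b) :
      HasDerivAt (fun s => φ s - c / 2 * (s - a) ^ 2) (φ' s - c * (s - a)) s := by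
    refine ((hφ s hs).sub
      ((((hasDerivAt_id s).sub_const a).pow 2).const_mul (c / 2))).congr_deriv ?_
    simp only [Nat.cast_ofNat, id_eq, Nat.add_one_sub_one, pow_one, mul_one]
    ring
  have hψ' (s) (hs : s ∈ Set.Icc a b) :
      HasDerivAt (fun s => φ' s - c * (s - a)) (φ'' s - c) s :=
    ((hφ' s hs).fun_sub (((hasDerivAt_id' s).sub_const a).const_mul c)).congr_deriv (by simp)
  have hconvex : ConvexOn ℝ (Set.Icc a b) fun s => φ s - c / 2 * (s - a) ^ 2 := by
    refine convexOn_of_hasDerivWithinAt2_nonneg (convex_Icc a b)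
      (fun s hs => (hψ s hs).continuousAt.continuousWithinAt)
      (fun s hs => (hψ s (interior_subset hs)).hasDerivWithinAt)
      (fun s hs => (hψ' s (interior_subset hs)).hasDerivWithinAt)
      fun s hs => sub_nonneg.2 (hc s (interior_subset hs))
  have hslope := hconvex.le_slope_of_hasDerivAt (Set.left_mem_Icc.2 hab.le)
    (Set.right_mem_Icc.2 hab.le) hab (hψ a (Set.left_mem_Icc.2 hab.le))
  rw [slope_def_field, le_div_iff₀ (sub_pos.2 hab)] at hslope
  linarith

variable {V : Type*} [NormedAddCommGroup V] [InnerProductSpace ℝ V]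

theorem inner_normalize_sub_nonneg (g : V) {x : V} (hx : ‖x‖ ≤ 1) :
    0 ≤ inner ℝ g (‖g‖⁻¹ • g - x) := by
  rw [inner_sub_right, real_inner_smul_right, real_inner_self_eq_norm_sq, sq, sub_nonneg,
    ← mul_assoc]
  calc inner ℝ g x ≤ ‖g‖ * ‖x‖ := real_inner_le_norm g x
    _ ≤ ‖g‖ := mul_le_of_le_one_right (norm_nonneg g) hx
    _ = ‖g‖⁻¹ * ‖g‖ * ‖g‖ := by
      rcases eq_or_ne ‖g‖ 0 with hg | hg
      · simp [hg]
      · rw [inv_mul_cancel₀ hg, one_mul]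

theorem norm_sub_inner_smul_le (g : V) {x : V} (hx : ‖x‖ = 1) (c : ℝ) :
    ‖g - inner ℝ g x • x‖ ≤ ‖g - c • x‖ := by
  refine le_of_sq_le_sq ?_ (norm_nonneg _)
  simp only [norm_sub_sq_real, norm_smul, hx, real_inner_smul_right, mul_one, Real.norm_eq_abs,
    sq_abs]
  linarith [sq_nonneg (inner ℝ g x - c)]

theorem norm_sub_inner_smul_le_norm_mul_norm_normalize_sub (g : V) {x : V} (hx : ‖x‖ = 1) :
    ‖g - inner ℝ g x • x‖ ≤ ‖g‖ * ‖‖g‖⁻¹ • g - x‖ := by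
  rcases eq_or_ne g 0 with rfl | hg
  · simp
  calc ‖g - inner ℝ g x • x‖ ≤ ‖g - ‖g‖ • x‖ := norm_sub_inner_smul_le g hx ‖g‖
    _ = ‖‖g‖ • (‖g‖⁻¹ • g - x)‖ := by rw [smul_sub, smul_inv_smul₀ (norm_ne_zero_iff.2 hg)]
    _ = ‖g‖ * ‖‖g‖⁻¹ • g - x‖ := by rw [norm_smul, norm_norm]

variable {m n : ℕ}

/-- A number `β ≥ 0` such that the matrices `(m - 1) A x^{m-2} + β` are positive semidefinite for
`x` in the unit ball. Up to the factor `m` these are the Hessians of `A x^m + (m β / 2) ‖x‖²`, which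
is thus convex on the ball. -/
structure IsConvexifyingShift (A : Tensor m n) (β : ℝ) : Prop where
  nonneg : 0 ≤ β
  posSemidef : ∀ x : EuclideanSpace ℝ (Fin n), ‖x‖ ≤ 1 →
    (((m : ℝ) - 1) • contractMat A x + β • (1 : Matrix (Fin n) (Fin n) ℝ)).PosSemidef

theorem isConvexifyingShift_beta (hm : 2 ≤ m) {E : Tensor m n} (hE : IsSymmetric E) :
    IsConvexifyingShift E (beta E) where
  nonneg := beta_nonneg (one_le_two.trans hm) E
  posSemidef _ hx := posSemidef_contractMat_add_beta hm hE hx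

theorem IsConvexifyingShift.add_left (hm : 1 ≤ m) {B E : Tensor m n} {β : ℝ}
    (hE : IsConvexifyingShift E β) (hB : ∀ x, (contractMat B x).PosSemidef) :
    IsConvexifyingShift (B + E) β where
  nonneg := hE.nonneg
  posSemidef x hx := by
    rw [contractMat_add, smul_add, add_assoc]
    exact ((hB x).smul (sub_nonneg.2 (by exact_mod_cast hm))).add (hE.posSemidef x hx)

variable {A : Tensor m n} {α β : ℝ} {x y : EuclideanSpace ℝ (Fin n)}

theorem IsConvexifyingShift.neg_mul_norm_sq_le (hβ : IsConvexifyingShift A β) (hx : ‖x‖ ≤ 1)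
    (v : EuclideanSpace ℝ (Fin n)) :
    -β * ‖v‖ ^ 2 ≤ ((m : ℝ) - 1) * v.ofLp ⬝ᵥ (contractMat A x).mulVec v := by
  have hnorm : v.ofLp ⬝ᵥ v.ofLp = ‖v‖ ^ 2 := by
    rw [EuclideanSpace.real_norm_sq_eq]
    simp only [dotProduct, sq]
  have h := (hβ.posSemidef x hx).dotProduct_mulVec_nonneg v.ofLp
  simp only [star_trivial, Matrix.add_mulVec, Matrix.smul_mulVec, Matrix.one_mulVec,
    dotProduct_add, dotProduct_smul, smul_eq_mul, hnorm] at h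
  linarith

theorem inner_shiftedMap_self (hm : 1 ≤ m) (A : Tensor m n) (α : ℝ) (hx : ‖x‖ = 1) :
    inner ℝ (shiftedMap A α x) x = rayleigh A x + α := by
  rw [shiftedMap, inner_add_left, real_inner_smul_left, real_inner_self_eq_norm_sq, hx,
    rayleigh_eq_inner hm, one_pow, mul_one]

theorem IsConvexifyingShift.shiftedMap_ne_zero (hm : 2 ≤ m) (hβ : IsConvexifyingShift A β)
    (hα : β < α) (hx : ‖x‖ = 1) : shiftedMap A α x ≠ 0 := by
  intro hzero
  have hm' : (2 : ℝ) ≤ m := by exact_mod_cast hm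
  have hray : rayleigh A x = -α := by
    have := inner_shiftedMap_self (by omega) A α hx
    rw [hzero, inner_zero_left] at this
    linarith
  have hquad : x.ofLp ⬝ᵥ (contractMat A x).mulVec x = rayleigh A x := by
    rw [rayleigh_eq_inner (by omega), PiLp.inner_apply, ofLp_contractVec hm]
    simp [dotProduct]
  have hlow := hβ.neg_mul_norm_sq_le hx.le x
  rw [hquad, hx, hray] at hlow
  nlinarith [hβ.nonneg]

theorem IsConvexifyingShift.rayleigh_add_le (hm : 1 ≤ m) (hA : IsSymmetric A)
    (hβ : IsConvexifyingShift A β) (α : ℝ) (hx : ‖x‖ = 1) (hy : ‖y‖ = 1) :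
    rayleigh A x + m * inner ℝ (shiftedMap A α x) (y - x) + m * (α - β) / 2 * ‖y - x‖ ^ 2 ≤
      rayleigh A y := by
  have hball (s : ℝ) (hs : s ∈ Set.Icc (0 : ℝ) 1) : ‖x + s • (y - x)‖ ≤ 1 := by
    have := (convex_closedBall (0 : EuclideanSpace ℝ (Fin n)) 1).add_smul_sub_mem
      (by simp [hx]) (by simp [hy]) hs (x := x) (y := y)
    simpa using this
  have htaylor := add_sq_le_of_le_deriv2 zero_lt_one (c := (m : ℝ) * (-β * ‖y - x‖ ^ 2))
    (fun s _ => hasDerivAt_rayleigh hA x (y - x) s)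
    (fun s _ => (hasDerivAt_inner_contractVec hm hA x (y - x) s).const_mul (m : ℝ))
    (fun s hs => mul_le_mul_of_nonneg_left (hβ.neg_mul_norm_sq_le (hball s hs) _)
      (Nat.cast_nonneg m))
  simp only [zero_smul, add_zero, one_smul, add_sub_cancel, sub_zero, mul_one, one_pow] at htaylor
  have hinner : inner ℝ x (y - x) = -(1 / 2) * ‖y - x‖ ^ 2 := by
    rw [inner_sub_right, real_inner_self_eq_norm_sq, norm_sub_sq_real, hx, hy, real_inner_comm]
    ring
  rw [shiftedMap, inner_add_left, real_inner_smul_left, hinner]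
  linarith

variable {x₀ : EuclideanSpace ℝ (Fin n)}

theorem IsConvexifyingShift.norm_ssHopm (hm : 2 ≤ m) (hβ : IsConvexifyingShift A β)
    (hα : β < α) (hx₀ : ‖x₀‖ = 1) (k : ℕ) : ‖ssHopm A α x₀ k‖ = 1 := by
  induction k with
  | zero => exact hx₀
  | succ k ih => exact norm_smul_inv_norm (𝕜 := ℝ) (hβ.shiftedMap_ne_zero hm hα ih)

theorem IsConvexifyingShift.mul_dist_sq_le_rayleigh_sub (hm : 2 ≤ m) (hA : IsSymmetric A)
    (hβ : IsConvexifyingShift A β) (hα : β < α) (hx₀ : ‖x₀‖ = 1) (k : ℕ) :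
    m * (α - β) / 2 * dist (ssHopm A α x₀ k) (ssHopm A α x₀ (k + 1)) ^ 2 ≤
      rayleigh A (ssHopm A α x₀ (k + 1)) - rayleigh A (ssHopm A α x₀ k) := by
  have hnorm := hβ.norm_ssHopm hm hα hx₀
  have hinner : 0 ≤ (m : ℝ) * inner ℝ (shiftedMap A α (ssHopm A α x₀ k))
      (ssHopm A α x₀ (k + 1) - ssHopm A α x₀ k) :=
    mul_nonneg (Nat.cast_nonneg m) (inner_normalize_sub_nonneg _ (hnorm k).le)
  rw [dist_comm, dist_eq_norm]
  linarith [hβ.rayleigh_add_le (by omega) hA α (hnorm k) (hnorm (k + 1))]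

end Ascent

section Convergence

open Filter Topology

variable {m n : ℕ} {A : Tensor m n} {α β : ℝ} {x x₀ : EuclideanSpace ℝ (Fin n)}

/-- For `‖x‖ = 1`, the component of `A x^{m-1}` orthogonal to `x`. It vanishes exactly at the
eigenvectors of `A`. -/
def tangentialVec (A : Tensor m n) (x : EuclideanSpace ℝ (Fin n)) : EuclideanSpace ℝ (Fin n) :=
  contractVec A x - rayleigh A x • x

theorem continuous_tangentialVec (A : Tensor m n) : Continuous (tangentialVec A) :=
  (continuous_contractVec A).sub ((continuous_rayleigh A).smul continuous_id)

theorem isEigenvector_of_tangentialVec_eq_zero (hx : ‖x‖ = 1) (h : tangentialVec A x = 0) :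
    IsEigenvector A x :=
  ⟨hx, _, sub_eq_zero.1 h⟩

theorem tangentialVec_eq_shiftedMap_sub (hm : 1 ≤ m) (A : Tensor m n) (α : ℝ) (hx : ‖x‖ = 1) :
    tangentialVec A x = shiftedMap A α x - inner ℝ (shiftedMap A α x) x • x := by
  rw [inner_shiftedMap_self hm A α hx, tangentialVec, shiftedMap]
  module

theorem norm_tangentialVec_ssHopm_le (hm : 1 ≤ m) {k : ℕ} (hk : ‖ssHopm A α x₀ k‖ = 1) :
    ‖tangentialVec A (ssHopm A α x₀ k)‖ ≤
      ‖shiftedMap A α (ssHopm A α x₀ k)‖ * dist (ssHopm A α x₀ k) (ssHopm A α x₀ (k + 1)) := by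
  rw [tangentialVec_eq_shiftedMap_sub hm A α hk, dist_comm, dist_eq_norm]
  exact norm_sub_inner_smul_le_norm_mul_norm_normalize_sub _ hk

theorem rpow_div_succ_le_of_pow_le_sq_pow {s t : ℝ} (hs : 0 ≤ s) (ht : 0 ≤ t) {N : ℕ}
    (h : t ^ (2 * N + 1) ≤ (s ^ 2) ^ (N + 1)) : t ^ ((2 * N + 1 : ℝ) / (2 * N + 2)) ≤ s := by
  have hpos : (0 : ℝ) < 2 * N + 2 := by positivity
  rw [← Real.rpow_le_rpow_iff (by positivity) hs hpos, ← Real.rpow_mul ht,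
    div_mul_cancel₀ _ hpos.ne']
  rw [← pow_mul] at h
  exact_mod_cast h

theorem exists_abs_sub_rayleigh_rpow_le (hm : 1 ≤ m) (hA : IsSymmetric A) (L : ℝ) :
    ∃ θ : ℝ, 0 ≤ θ ∧ θ < 1 ∧ ∃ δ : ℝ, 0 < δ ∧ ∀ x : EuclideanSpace ℝ (Fin n), ‖x‖ = 1 →
      |L - rayleigh A x| < δ → |L - rayleigh A x| ^ θ ≤ m * ‖tangentialVec A x‖ := by
  obtain ⟨N, δ, hδ, h⟩ :=
    exists_abs_pow_le_tangential_gradient_pow (MvPolynomial.C L - rayleighPoly A)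
  refine ⟨(2 * N + 1) / (2 * N + 2), by positivity,
    (div_lt_one (by positivity)).2 (by linarith), δ, hδ, fun x hx hlt => ?_⟩
  refine rpow_div_succ_le_of_pow_le_sq_pow (by positivity) (abs_nonneg _) ?_
  have hgrad (i : Fin n) : MvPolynomial.eval x (MvPolynomial.pderiv i
      (MvPolynomial.C L - rayleighPoly A)) = -(m * contractVec A x i) := by
    simp [eval_pderiv_rayleighPoly hA]
  have hradial : ∑ j, x j * -(m * contractVec A x j) = -(m * rayleigh A x) := by
    rw [rayleigh_eq_inner hm, PiLp.inner_apply, Finset.mul_sum, ← Finset.sum_neg_distrib]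
    exact Finset.sum_congr rfl fun j _ => by
      simp only [RCLike.inner_apply, Real.ringHom_apply]
      ring
  have htan : ∑ i, (-(m * contractVec A x i) - -(m * rayleigh A x) * x i) ^ 2 =
      (m * ‖tangentialVec A x‖) ^ 2 := by
    rw [mul_pow, EuclideanSpace.real_norm_sq_eq, Finset.mul_sum]
    exact Finset.sum_congr rfl fun i _ => by
      simp only [tangentialVec, PiLp.sub_apply, PiLp.smul_apply, smul_eq_mul]
      ring
  have heval : MvPolynomial.eval x (MvPolynomial.C L - rayleighPoly A) = L - rayleigh A x := by
    rw [map_sub, MvPolynomial.eval_C, eval_rayleighPoly]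
  have hloj := h x (by rw [← EuclideanSpace.real_norm_sq_eq, hx, one_pow]) (by rwa [heval])
  simpa only [heval, hgrad, hradial, htan] using hloj

theorem exists_norm_shiftedMap_le (A : Tensor m n) (α : ℝ) :
    ∃ B : ℝ, 0 ≤ B ∧ ∀ x : EuclideanSpace ℝ (Fin n), ‖x‖ = 1 → ‖shiftedMap A α x‖ ≤ B := by
  have hcont : Continuous (shiftedMap A α) :=
    (continuous_contractVec A).add (continuous_id.const_smul α)
  obtain ⟨B, hB⟩ := (isCompact_sphere (0 : EuclideanSpace ℝ (Fin n)) 1).exists_bound_of_continuousOn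
    hcont.continuousOn
  exact ⟨max B 0, le_max_right _ _, fun x hx => le_max_of_le_left (hB x (by simpa using hx))⟩

theorem IsConvexifyingShift.rayleigh_ssHopm_le_succ (hm : 2 ≤ m) (hA : IsSymmetric A)
    (hβ : IsConvexifyingShift A β) (hα : β < α) (hx₀ : ‖x₀‖ = 1) (k : ℕ) :
    rayleigh A (ssHopm A α x₀ k) ≤ rayleigh A (ssHopm A α x₀ (k + 1)) := by
  refine sub_nonneg.1 (le_trans ?_ (hβ.mul_dist_sq_le_rayleigh_sub hm hA hα hx₀ k))
  have := sub_pos.2 hα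
  positivity

theorem IsConvexifyingShift.rayleigh_ssHopm_lt_succ (hm : 2 ≤ m) (hA : IsSymmetric A)
    (hβ : IsConvexifyingShift A β) (hα : β < α) (hx₀ : ‖x₀‖ = 1) {k : ℕ}
    (hk : ¬ IsEigenvector A (ssHopm A α x₀ k)) :
    rayleigh A (ssHopm A α x₀ k) < rayleigh A (ssHopm A α x₀ (k + 1)) := by
  have hnorm := hβ.norm_ssHopm hm hα hx₀ k
  have hτ : 0 < ‖tangentialVec A (ssHopm A α x₀ k)‖ :=
    norm_pos_iff.2 fun h => hk (isEigenvector_of_tangentialVec_eq_zero hnorm h)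
  have hstep : 0 < dist (ssHopm A α x₀ k) (ssHopm A α x₀ (k + 1)) :=
    pos_of_mul_pos_right (hτ.trans_le (norm_tangentialVec_ssHopm_le (by omega) hnorm))
      (norm_nonneg _)
  refine sub_pos.1 (lt_of_lt_of_le ?_ (hβ.mul_dist_sq_le_rayleigh_sub hm hA hα hx₀ k))
  have := sub_pos.2 hα
  positivity

theorem IsConvexifyingShift.exists_tendsto_rayleigh_ssHopm (hm : 2 ≤ m) (hA : IsSymmetric A)
    (hβ : IsConvexifyingShift A β) (hα : β < α) (hx₀ : ‖x₀‖ = 1) :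
    ∃ L, (∀ k, rayleigh A (ssHopm A α x₀ k) ≤ L) ∧
      Tendsto (fun k => rayleigh A (ssHopm A α x₀ k)) atTop (𝓝 L) := by
  have hmono : Monotone fun k => rayleigh A (ssHopm A α x₀ k) :=
    monotone_nat_of_le_succ (hβ.rayleigh_ssHopm_le_succ hm hA hα hx₀)
  obtain ⟨R, hR⟩ := (isCompact_sphere (0 : EuclideanSpace ℝ (Fin n)) 1).bddAbove_image
    (continuous_rayleigh A).continuousOn
  have hbdd : BddAbove (Set.range fun k => rayleigh A (ssHopm A α x₀ k)) :=
    ⟨R, by rintro _ ⟨k, rfl⟩; exact hR ⟨_, by simpa using hβ.norm_ssHopm hm hα hx₀ k, rfl⟩⟩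
  exact ⟨_, le_ciSup hbdd, tendsto_atTop_ciSup hmono hbdd⟩

theorem IsConvexifyingShift.exists_tendsto_ssHopm (hm : 2 ≤ m) (hA : IsSymmetric A)
    (hβ : IsConvexifyingShift A β) (hα : β < α) (hx₀ : ‖x₀‖ = 1) :
    ∃ z, Tendsto (ssHopm A α x₀) atTop (𝓝 z) := by
  have hm1 : 1 ≤ m := by omega
  obtain ⟨L, hle, hlim⟩ := hβ.exists_tendsto_rayleigh_ssHopm hm hA hα hx₀
  obtain ⟨θ, hθ0, hθ1, δ, hδ, hloj⟩ := exists_abs_sub_rayleigh_rpow_le hm1 hA L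
  obtain ⟨B, hB0, hB⟩ := exists_norm_shiftedMap_le A α
  have hc : 0 < m * (α - β) / 2 := by
    have := sub_pos.2 hα
    positivity
  refine exists_tendsto_of_lojasiewicz (t := fun k => L - rayleigh A (ssHopm A α x₀ k))
    (C := m * B) (fun k => sub_nonneg.2 (hle k)) hc (by positivity) hθ0 hθ1 (fun k => ?_) ?_
  · rw [sub_sub_sub_cancel_left]
    exact hβ.mul_dist_sq_le_rayleigh_sub hm hA hα hx₀ k
  · filter_upwards [hlim.eventually (lt_mem_nhds (sub_lt_self L hδ))] with k hk
    have hnorm := hβ.norm_ssHopm hm hα hx₀ k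
    have hgap := abs_of_nonneg (sub_nonneg.2 (hle k))
    calc (L - rayleigh A (ssHopm A α x₀ k)) ^ θ
        ≤ m * ‖tangentialVec A (ssHopm A α x₀ k)‖ := by
          simpa only [hgap] using hloj _ hnorm (by rw [hgap]; linarith)
      _ ≤ m * (‖shiftedMap A α (ssHopm A α x₀ k)‖ * _) := by
          gcongr
          exact norm_tangentialVec_ssHopm_le hm1 hnorm
      _ ≤ m * B * _ := by
          rw [mul_assoc]
          gcongr
          exact hB _ hnorm

theorem IsConvexifyingShift.isEigenvector_of_tendsto_ssHopm (hm : 2 ≤ m)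
    (hβ : IsConvexifyingShift A β) (hα : β < α) (hx₀ : ‖x₀‖ = 1) {z : EuclideanSpace ℝ (Fin n)}
    (hz : Tendsto (ssHopm A α x₀) atTop (𝓝 z)) : IsEigenvector A z := by
  have hnorm := hβ.norm_ssHopm hm hα hx₀
  obtain ⟨B, -, hB⟩ := exists_norm_shiftedMap_le A α
  refine isEigenvector_of_tangentialVec_eq_zero
    (tendsto_nhds_unique hz.norm (by simp [hnorm])) ?_
  have hstep : Tendsto (fun k => B * dist (ssHopm A α x₀ k) (ssHopm A α x₀ (k + 1))) atTop
      (𝓝 0) := by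
    simpa using (hz.dist (hz.comp (tendsto_add_atTop_nat 1))).const_mul B
  have htan (k : ℕ) : ‖tangentialVec A (ssHopm A α x₀ k)‖ ≤
      B * dist (ssHopm A α x₀ k) (ssHopm A α x₀ (k + 1)) :=
    (norm_tangentialVec_ssHopm_le (by omega) (hnorm k)).trans
      (mul_le_mul_of_nonneg_right (hB _ (hnorm k)) dist_nonneg)
  exact tendsto_nhds_unique ((continuous_tangentialVec A).tendsto z |>.comp hz)
    (squeeze_zero_norm htan hstep)

end Convergence

end SymTensor

end

theorem mainTheorem3_general {m n : ℕ} (hm : 2 ≤ m) {B E : SymTensor.Tensor m n}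
    (hB : SymTensor.IsSymmetric B) (hB_nonneg : ∀ x, (SymTensor.contractMat B x).PosSemidef)
    (hE : SymTensor.IsSymmetric E) {α : ℝ} (hα : SymTensor.beta E < α)
    {x₀ : EuclideanSpace ℝ (Fin n)} (hx₀ : ‖x₀‖ = 1) :
    (∀ k, SymTensor.shiftedMap (B + E) α (SymTensor.ssHopm (B + E) α x₀ k) ≠ 0) ∧
    (∀ k, SymTensor.rayleigh (B + E) (SymTensor.ssHopm (B + E) α x₀ k) ≤
      SymTensor.rayleigh (B + E) (SymTensor.ssHopm (B + E) α x₀ (k + 1))) ∧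
    (∀ k, ¬ SymTensor.IsEigenvector (B + E) (SymTensor.ssHopm (B + E) α x₀ k) →
      SymTensor.rayleigh (B + E) (SymTensor.ssHopm (B + E) α x₀ k) <
        SymTensor.rayleigh (B + E) (SymTensor.ssHopm (B + E) α x₀ (k + 1))) ∧
    ∃ x : EuclideanSpace ℝ (Fin n), SymTensor.IsEigenvector (B + E) x ∧
      Filter.Tendsto (SymTensor.ssHopm (B + E) α x₀) Filter.atTop (nhds x) := by
  have hA : SymTensor.IsSymmetric (B + E) := hB.add hE
  have hβ : SymTensor.IsConvexifyingShift (B + E) (SymTensor.beta E) :=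
    (SymTensor.isConvexifyingShift_beta hm hE).add_left (one_le_two.trans hm) hB_nonneg
  obtain ⟨x, hx⟩ := hβ.exists_tendsto_ssHopm hm hA hα hx₀
  exact ⟨fun k => hβ.shiftedMap_ne_zero hm hα (hβ.norm_ssHopm hm hα hx₀ k),
    hβ.rayleigh_ssHopm_le_succ hm hA hα hx₀,
    fun _ hk => hβ.rayleigh_ssHopm_lt_succ hm hA hα hx₀ hk,
    x, hβ.isEigenvector_of_tendsto_ssHopm hm hα hx₀ hx, hx⟩

theorem mainTheorem3 {m n : ℕ} (hm : 2 ≤ m) (hm_even : Even m)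
    (a : EuclideanSpace ℝ (Fin n)) (ha : ‖a‖ = 1)
    (E : SymTensor.Tensor m n) (hE : SymTensor.IsSymmetric E)
    (A : SymTensor.Tensor m n) (lam : ℝ) (hlam : 0 < lam)
    (hA : A = lam • SymTensor.rankOne m a + E)
    (α : ℝ) (hα : SymTensor.beta E < α)
    (x₀ : EuclideanSpace ℝ (Fin n)) (hx₀ : ‖x₀‖ = 1) :
    (∀ k, SymTensor.shiftedMap A α (SymTensor.ssHopm A α x₀ k) ≠ 0) ∧
    (∀ k, SymTensor.rayleigh A (SymTensor.ssHopm A α x₀ k) ≤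
      SymTensor.rayleigh A (SymTensor.ssHopm A α x₀ (k + 1))) ∧
    (∀ k, ¬ SymTensor.IsEigenvector A (SymTensor.ssHopm A α x₀ k) →
      SymTensor.rayleigh A (SymTensor.ssHopm A α x₀ k) <
        SymTensor.rayleigh A (SymTensor.ssHopm A α x₀ (k + 1))) ∧
    ∃ x : EuclideanSpace ℝ (Fin n), SymTensor.IsEigenvector A x ∧
      Filter.Tendsto (SymTensor.ssHopm A α x₀) Filter.atTop (nhds x) := by
  subst hA
  exact mainTheorem3_general hm ((SymTensor.isSymmetric_rankOne a).smul lam)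
    (fun x => SymTensor.contractMat_smul lam _ x ▸
      (SymTensor.posSemidef_contractMat_rankOne hm hm_even a x).smul hlam.le) hE hα hx₀
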